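/- **Order book.** Fix integers $K,\bar M\ge 0$, boundary volumes $a_\infty,|b_\infty|\in\mathbb N$ and a horizon $T$. A state is $z=(x,y,\underline a,\underline b,\underline{na},\underline{nb},\underline{ra},\underline{rb},pa,pb)$: cash $x\in\mathbb R$, inventory $y\in\mathbb Z$, ask and bid price $pa,pb\in\mathbb R$ (tick size 1); $a_i$ (resp. $|b_i|$) $\in\mathbb N$, $0\le i<K$, is the number of general participants' sell (resp. buy) orders $i+1$ ticks away from the best bid (resp. best ask); $ra_j, rb_j\in\{0,\dots,K-1\}\cup\{-1\}$, $1\le j\le\bar M$, are the limits at which the market maker's orders stand ($-1$: not placed), and $na_j,nb_j$ their ranks in the FIFO queues ($-1$: not placed). $E$ is the set of states. Let $a0(z)$ be the least $i$ with $a_i>0$ ($K$ if there is none). In state $z$ the admissible decisions are $A_z=\{(\underline{ra}',\underline{rb}')\in(\{-1,\dots,K-1\}^{\bar M})^2:\ \text{every entry}\ \ne -1\ \text{is}\ \ge a0(z)\}$. After decision $u$ the state is $\phi^u(z)$: her orders stand at the limits $u$; an order that stays at its limit keeps its place in the queue, a new one goes to the end of its queue, the others are withdrawn. General participants send unit orders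 of $4K+2$ kinds: market buy/sell, and limit and cancel orders at each limit of each side. A limit order joins the end of its queue. A cancellation at a limit removes one of the general participants' orders there, chosen uniformly (nothing happens if there is none). A market order executes the first order of the queue at the best limit; if this is the market maker's, her cash and inventory change by the traded price and one share (nothing happens if the frame of that side is empty). When the best price of a side moves, $pa$ or $pb$ follows and the opposite side is re-indexed: limits entering the frame from outside contain $a_\infty$ (resp. $|b_\infty|$) orders, limits lying at or beyond the former best price of the side that moved are empty, and orders of the market maker leaving the frame are removed. The intensities $\lambda^e\ge 0$ of the kinds $e$ depend only on $(\underline a,\underline b)$ and satisfy $\lambda^e(\underline a,\underline b)\le C(1+|\underline a|+|\underline b|)$ for some constant $C$. Put $\lambda(z)=\sum_e\lambda^e(z)$, and let $Q'(\cdot\mid z,u)=\sum_e\frac{\lambda^e(z)}{\lambda(z)}\,\mathrm{Law}\big(\text{state after event } e \text{ in state } \phi^u(z)\big)$. **Continuous-time problem.** An admissible policy is a sequence $\alpha=(f_n)_{n\ge0}$ of measurable feedback maps with $f_n(t,z)\in A_z$. Given $\alpha$ and $(t,z)\in[0,T]\times E$, let $(T_0,Z_0)=(t,z)$ and, conditionally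 on $(T_k,Z_k)_{k\le n}$, let $T_{n+1}-T_n$ be exponential with parameter $\lambda(Z_n)$ and independent of $Z_{n+1}\sim Q'(\cdot\mid Z_n,f_n(T_n,Z_n))$ (no further jump if $\lambda(Z_n)=0$). For $T_n\le s<T_{n+1}$ the control is $\alpha_s=f_n(T_n,Z_n)$ and the order book is in the state $Z_s=\phi^{\alpha_s}(Z_n)$. Let $f$ (running reward) and $g$ (terminal reward) be real and measurable, and $$V(t,z)=\sup_{\alpha}\ \mathbb E^\alpha_{t,z}\Big[\int_t^T f(\alpha_s,Z_s)\,ds+g(Z_T)\Big],$$ under the assumption that for every $(t,z)\in[0,T]\times E$ one has $\sup_\alpha\mathbb E^\alpha_{t,z}\big[\int_t^T f^+(\alpha_s,Z_s)ds\big]<\infty$, and that there are $c,d$ with $g(Z_T)\le c(1+N_T)^d$ almost surely for every $\alpha$, where $N_T$ is the number of order arrivals in $(t,T]$. (Expectations are $\mathbb E[X^+]-\mathbb E[X^-]\in[-\infty,\infty)$.) **Decision process.** The discrete-time, infinite-horizon Markov decision process has states $(t,z)\in[0,T]\times E$ and an absorbing cemetery $\Delta$, actions $A_z$, transition law $$Q(B\times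 C\mid t,z,u)=\lambda(z)\int_0^{T-t}e^{-\lambda(z)s}\mathbf 1_B(t+s)\,Q'(C\mid z,u)\,ds,\qquad Q(\{\Delta\}\mid t,z,u)=e^{-\lambda(z)(T-t)},$$ reward $0$ at $\Delta$ and $$r(t,z,u)=f(u,\phi^u(z))\Big(\frac1{\lambda(z)}-\frac{e^{-\lambda(z)(T-t)}}{\lambda(z)}\Big)+e^{-\lambda(z)(T-t)}g(\phi^u(z)),$$ where the bracket is read as $T-t$ if $\lambda(z)=0$. Its value function is $V_\infty(t,z)=\sup_{(f_n)}\mathbb E^{(f_n)}_{t,z}\big[\sum_{n\ge0}r(T_n,Z_n,f_n(T_n,Z_n))\big]$, the supremum being over the same admissible policies and the reward being $0$ once the chain has reached $\Delta$. **Proposition.** For all $(t,z)\in[0,T]\times E$: $\;V_\infty(t,z)=V(t,z)$. -/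

import Mathlib

open MeasureTheory ProbabilityTheory Set
open scoped ENNReal NNReal

noncomputable section

namespace MarketMaking

/-! ### States, actions, events -/

/-- One side of the order book, seen through a frame of `K` limits. Limit `i : Fin K` lies `i + 1`
ticks away from the best price of the opposite side. `vol i` is the number of orders of general
participants at limit `i` (for the bid side it is the absolute value of the usual signed quantity).
The market maker has `M` order slots on this side: `loc j` is the limit of her `j`-th order, with
`none` for an order that is not placed, and `rank j` is the position of that order in its FIFO
queue, counted from `1` (all orders counted, hers included), with `-1` for an order that is not
placed. -/
@[ext]
structure Side (K M : ℕ) where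
  vol : Fin K → ℕ
  loc : Fin M → Option (Fin K)
  rank : Fin M → ℤ

/-- The integer-valued part of the state: inventory of the market maker and both sides. -/
@[ext]
structure Config (K M : ℕ) where
  inv : ℤ
  ask : Side K M
  bid : Side K M

/-- State `z = ((x, pa, pb), (y, (a, ra, na), (b, rb, nb)))` of the controlled order book:
cash, ask price and bid price (tick size `1`), then the integer-valued part. -/
abbrev State (K M : ℕ) := (ℝ × ℝ × ℝ) × Config K M

/-- A decision: the limits at which the `M` sell orders and the `M` buy orders of the market maker
are to stand (`none`: not placed). -/
@[ext]
structure Action (K M : ℕ) where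
  ask : Fin M → Option (Fin K)
  bid : Fin M → Option (Fin K)

/-- The `4 K + 2` kinds of orders of the general participants. -/
inductive Event (K : ℕ)
  | marketBuy
  | marketSell
  | limitAsk (i : Fin K)
  | limitBid (i : Fin K)
  | cancelAsk (i : Fin K)
  | cancelBid (i : Fin K)
  deriving DecidableEq, Fintype

instance (K M : ℕ) : Inhabited (Side K M) := ⟨⟨fun _ => 0, fun _ => none, fun _ => -1⟩⟩
instance (K M : ℕ) : Inhabited (Config K M) := ⟨⟨0, default, default⟩⟩
instance (K M : ℕ) : Inhabited (Action K M) := ⟨⟨fun _ => none, fun _ => none⟩⟩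

instance (K M : ℕ) : Countable (Side K M) :=
  Function.Injective.countable (f := fun s : Side K M => (s.vol, s.loc, s.rank)) (by
    rintro ⟨_, _, _⟩ ⟨_, _, _⟩ h; simpa using h)

instance (K M : ℕ) : Countable (Config K M) :=
  Function.Injective.countable (f := fun c : Config K M => (c.inv, c.ask, c.bid)) (by
    rintro ⟨_, _, _⟩ ⟨_, _, _⟩ h; simpa using h)

instance (K M : ℕ) : Countable (Action K M) :=
  Function.Injective.countable (f := fun a : Action K M => (a.ask, a.bid)) (by
    rintro ⟨_, _⟩ ⟨_, _⟩ h; simpa using h)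

instance (K M : ℕ) : MeasurableSpace (Config K M) := ⊤
instance (K M : ℕ) : DiscreteMeasurableSpace (Config K M) := ⟨fun _ => trivial⟩
instance (K M : ℕ) : MeasurableSpace (Action K M) := ⊤
instance (K M : ℕ) : DiscreteMeasurableSpace (Action K M) := ⟨fun _ => trivial⟩

/-! ### Mechanics of one side of the book -/

/-- Index of the best limit: the first limit with an order of a general participant, and `K` if
there is none inside the frame. -/
def best {K : ℕ} (v : Fin K → ℕ) : ℕ := sInf {n : ℕ | ∀ h : n < K, 0 < v ⟨n, h⟩}

namespace Side

variable {K M : ℕ} (s : Side K M)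

/-- Number of orders of general participants that stand before the `j`-th order of the market maker
in its queue. -/
def generalAhead (j : Fin M) : ℤ :=
  s.rank j - 1 - Nat.card {i : Fin M // s.loc i = s.loc j ∧ s.rank i < s.rank j}

/-- Re-indexing when the best price of the opposite side moves away by `d` ticks (`d < 0`: comes
closer by `-d` ticks): the order that was at limit `i` is now at limit `i + d`. Limits that enter
the frame from outside contain `vInf` orders; limits that were at or beyond the opposite best price are
empty; orders of the market maker that leave the frame are removed. -/
def shift (d : ℤ) (vInf : ℕ) : Side K M :=
  let loc' : Fin M → Option (Fin K) := fun j =>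
    (s.loc j).bind fun l =>
      if h : 0 ≤ (l : ℤ) + d ∧ (l : ℤ) + d < K then some ⟨((l : ℤ) + d).toNat, by omega⟩ else none
  { vol := fun j =>
      if (j : ℤ) - d < 0 then 0
      else if h : (j : ℤ) - d < K ∧ 0 ≤ (j : ℤ) - d then s.vol ⟨((j : ℤ) - d).toNat, by omega⟩
      else vInf
    loc := loc'
    rank := fun j => if loc' j = none then -1 else s.rank j }

/-- A limit order of a general participant arrives at limit `i`, at the end of the queue. -/
def add (i : Fin K) : Side K M := { s with vol := Function.update s.vol i (s.vol i + 1) }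

open Classical in
/-- Among the orders of the general participants at limit `i`, the one which has exactly `k` of them
before it is cancelled. (Nothing happens if limit `i` holds no such order and `k = 0`.) -/
def cancel (i : Fin K) (k : ℕ) : Side K M :=
  { vol := Function.update s.vol i (s.vol i - 1)
    loc := s.loc
    rank := fun j =>
      if s.loc j = some i ∧ (k : ℤ) < s.generalAhead j then s.rank j - 1 else s.rank j }

/-- The `j`-th order of the market maker stands at the best limit. -/
def AtBest (j : Fin M) : Prop := ∃ l, s.loc j = some l ∧ (l : ℕ) = best s.vol

/-- The `j`-th order of the market maker is the first one of the queue at the best limit. (At most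
one of her orders has this rank; the minimality over slots makes this so for every element of the
type.) -/
def Front (j : Fin M) : Prop :=
  (s.AtBest j ∧ s.rank j = 1) ∧ ∀ i < j, ¬ (s.AtBest i ∧ s.rank i = 1)

/-- The next market order is executed against an order of the market maker. -/
def Hits : Prop := ∃ j, s.Front j

open Classical in
/-- A market order of size one executes the first order of the queue at the best limit. -/
def execute : Side K M :=
  { vol := fun i => if (i : ℕ) = best s.vol ∧ ¬ s.Hits then s.vol i - 1 else s.vol i
    loc := fun j => if s.Front j then none else s.loc j
    rank := fun j =>
      if s.Front j then -1 else if s.AtBest j then s.rank j - 1 else s.rank j }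

open Classical in
/-- The market maker places her orders at the limits `new`. An order that stays at its limit keeps
its place in the queue; any other placed order is new and goes to the end of its queue (in the order
of the slots); all the other orders of hers are withdrawn. -/
def place (new : Fin M → Option (Fin K)) : Side K M :=
  let ahead : Fin M → Fin M → Prop := fun i j =>
    new i = new j ∧
      if s.loc i = new i then (s.loc j = new j → s.rank i < s.rank j)
      else ¬ s.loc j = new j ∧ i < j
  { vol := s.vol
    loc := new
    rank := fun j =>
      match new j with
      | none => -1
      | some l =>
        (if s.loc j = some l then s.generalAhead j else (s.vol l : ℤ)) + 1
          + Nat.card {i : Fin M // ahead i j} }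

end Side

/-! ### Decisions of the market maker -/

/-- `φ^a(z)`: the state right after the decision `a`. -/
def afterDecision {K M : ℕ} (a : Action K M) (z : State K M) : State K M :=
  (z.1, { z.2 with ask := z.2.ask.place a.ask, bid := z.2.bid.place a.bid })

/-- The set `A_z` of the admissible decisions: all the placed orders stand at the index of the best
limit or further, so that the spread is not crossed. (In the frame, the index of the best limit is
the spread, the same one for the two sides.) -/
def admissible {K M : ℕ} (z : State K M) : Set (Action K M) :=
  {a | ∀ j l, (a.ask j = some l ∨ a.bid j = some l) → best z.2.ask.vol ≤ l}

/-! ### The model -/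

/-- Data of a market-making problem: the boundary conditions `a_∞` and `|b_∞|`, the intensities of
the orders of the general participants as functions of the volumes `(a, |b|)`, the horizon, the
running reward and the terminal reward. -/
structure Model (K M : ℕ) where
  askInf : ℕ
  bidInf : ℕ
  intensity : Event K → (Fin K → ℕ) → (Fin K → ℕ) → ℝ≥0
  T : ℝ
  f : Action K M → State K M → ℝ
  g : State K M → ℝ

namespace Model

variable {K M : ℕ} (m : Model K M)

/-- The ask side becomes `s`: the ask price follows the best ask limit and the bid side, whose
limits are counted from the ask price, is re-indexed. -/
def setAsk (z : State K M) (s : Side K M) : State K M :=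
  let d : ℤ := (best s.vol : ℤ) - best z.2.ask.vol
  ((z.1.1, z.1.2.1 + d, z.1.2.2), { inv := z.2.inv, ask := s, bid := z.2.bid.shift d m.bidInf })

/-- The bid side becomes `s`. -/
def setBid (z : State K M) (s : Side K M) : State K M :=
  let d : ℤ := (best s.vol : ℤ) - best z.2.bid.vol
  ((z.1.1, z.1.2.1, z.1.2.2 - d), { inv := z.2.inv, ask := z.2.ask.shift d m.askInf, bid := s })

/-- The market maker trades `n` shares at price `p` per share (`n < 0`: she sells). -/
def trade (z : State K M) (n : ℤ) (p : ℝ) : State K M :=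
  ((z.1.1 - n * p, z.1.2.1, z.1.2.2), { z.2 with inv := z.2.inv + n })

open Classical in
/-- State after the arrival of the order `e`, where `k` is the position (among the orders of the
general participants) of the cancelled order if `e` is a cancellation, and is not used otherwise. -/
def outcome (e : Event K) (k : ℕ) (z : State K M) : State K M :=
  match e with
  | .marketBuy =>
      m.setAsk (if z.2.ask.Hits then trade z (-1) z.1.2.1 else z) z.2.ask.execute
  | .marketSell =>
      m.setBid (if z.2.bid.Hits then trade z 1 z.1.2.2 else z) z.2.bid.execute
  | .limitAsk i => m.setAsk z (z.2.ask.add i)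
  | .limitBid i => m.setBid z (z.2.bid.add i)
  | .cancelAsk i => m.setAsk z (z.2.ask.cancel i k)
  | .cancelBid i => m.setBid z (z.2.bid.cancel i k)

/-- Number of equally likely values of `k` in `outcome`: the cancelled order is uniformly
distributed among the orders of the general participants at its limit. -/
def choices (e : Event K) (c : Config K M) : ℕ :=
  match e with
  | .cancelAsk i => max 1 (c.ask.vol i)
  | .cancelBid i => max 1 (c.bid.vol i)
  | _ => 1

/-- Law of the state after the arrival of the order `e` in state `z`. -/
def eventLaw (e : Event K) (z : State K M) : Measure (State K M) :=
  ∑ k ∈ Finset.range (choices e z.2), ((choices e z.2 : ℝ≥0∞))⁻¹ • Measure.dirac (m.outcome e k z)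

/-- Intensity of the order `e` in a state. -/
def rate (e : Event K) (c : Config K M) : ℝ≥0 := m.intensity e c.ask.vol c.bid.vol

/-- `λ(z)`: total intensity. -/
def totalRate (c : Config K M) : ℝ≥0 := ∑ e, m.rate e c

/-- `Q'(· | z, a)`: law of the state right after the next arrival, when decision `a` was taken in
state `z` (used only where `λ(z) ≠ 0`). -/
def jumpLaw (z : State K M) (a : Action K M) : Measure (State K M) :=
  ∑ e, ((m.rate e z.2 / m.totalRate z.2 : ℝ≥0) : ℝ≥0∞) • m.eventLaw e (afterDecision a z)

/-! ### One-step laws -/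

end Model

/-- Values of the embedded chains: `inl (t, z)` stands for a jump at time `t` with post-jump state
`z`. The point `inr ()` is a cemetery: in the continuous-time problem it means that no further order
ever arrives, in the decision process that the horizon was passed. -/
abbrev Node (K M : ℕ) := (ℝ × State K M) ⊕ Unit

namespace Model

variable {K M : ℕ} (m : Model K M)

open Classical in
/-- Law of the next jump time and post-jump state after a jump at time `t` to state `z` and decision
`a`: the waiting time is exponential with parameter `λ(z)` and independent of the new state. If
`λ(z) = 0` there is no further jump. -/
def nextJump (p : ℝ × State K M) (a : Action K M) : Measure (Node K M) :=
  if m.totalRate p.2.2 = 0 then Measure.dirac (Sum.inr ())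
  else ((expMeasure (m.totalRate p.2.2)).prod (m.jumpLaw p.2 a)).map
    fun q => Sum.inl (p.1 + q.1, q.2)

/-- Transition law of the decision process: for Borel sets `B`, `C`,
`Q(B × C | t, z, a) = λ(z) ∫_0^{T-t} e^{-λ(z) s} 1_B(t + s) Q'(C | z, a) ds`, and the remaining mass
`e^{-λ(z) (T - t)}` sits at the cemetery. -/
def mdpLaw (p : ℝ × State K M) (a : Action K M) : Measure (Node K M) :=
  (((volume.restrict (Ioc 0 (m.T - p.1))).withDensity fun s =>
      ENNReal.ofReal (m.totalRate p.2.2 * Real.exp (-(m.totalRate p.2.2 * s)))).prod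
      (m.jumpLaw p.2 a)).map (fun q => Sum.inl (p.1 + q.1, q.2))
    + ENNReal.ofReal (Real.exp (-(m.totalRate p.2.2 * max (m.T - p.1) 0)))
      • Measure.dirac (Sum.inr ())

/-! ### Measurability and total mass of the one-step laws -/

lemma measurable_of_config {α β : Type*} [MeasurableSpace α] [MeasurableSpace β]
    {F : α × State K M → β} (h : ∀ c, Measurable fun q : α × (ℝ × ℝ × ℝ) => F (q.1, q.2, c)) :
    Measurable F := by
  have h1 : Measurable fun q : (α × (ℝ × ℝ × ℝ)) × Config K M => F (q.1.1, q.1.2, q.2) :=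
    measurable_from_prod_countable_left h
  have h2 : Measurable fun q : α × State K M => ((q.1, q.2.1), q.2.2) := by fun_prop
  exact h1.comp h2

lemma measurable_outcome (e : Event K) (k : ℕ) (c : Config K M) :
    Measurable fun r : ℝ × ℝ × ℝ => m.outcome e k (r, c) := by
  classical
  cases e <;> simp only [outcome, setAsk, setBid, trade] <;> (try split_ifs) <;>
    (try dsimp only) <;> fun_prop

lemma measurable_jumpLaw (a : Action K M) (c : Config K M) :
    Measurable fun r : ℝ × ℝ × ℝ => m.jumpLaw (r, c) a := by
  refine Measure.measurable_of_measurable_coe _ fun B hB => ?_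
  simp only [jumpLaw, eventLaw, afterDecision, Measure.coe_finsetSum, Finset.sum_apply,
    Measure.smul_apply, smul_eq_mul]
  refine Finset.measurable_sum _ fun e _ => Measurable.const_mul ?_ _
  refine Finset.measurable_sum _ fun k _ => Measurable.const_mul ?_ _
  exact (Measure.measurable_coe hB).comp
    (Measure.measurable_dirac.comp (m.measurable_outcome e k _))

lemma isProbabilityMeasure_eventLaw (e : Event K) (z : State K M) :
    IsProbabilityMeasure (m.eventLaw e z) := by
  have h : choices e z.2 ≠ 0 := by cases e <;> simp [choices]
  refine ⟨?_⟩
  simp only [eventLaw, Measure.coe_finsetSum, Finset.sum_apply, Measure.smul_apply, smul_eq_mul,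
    measure_univ, mul_one, Finset.sum_const, Finset.card_range, nsmul_eq_mul]
  exact ENNReal.mul_inv_cancel (by exact_mod_cast h) (ENNReal.natCast_ne_top _)

lemma isProbabilityMeasure_jumpLaw (z : State K M) (a : Action K M) (h : m.totalRate z.2 ≠ 0) :
    IsProbabilityMeasure (m.jumpLaw z a) := by
  have h1 := fun e => m.isProbabilityMeasure_eventLaw e (afterDecision a z)
  refine ⟨?_⟩
  simp only [jumpLaw, Measure.coe_finsetSum, Finset.sum_apply, Measure.smul_apply, smul_eq_mul,
    measure_univ, mul_one]
  rw [← ENNReal.ofNNReal_finsetSum, ← Finset.sum_div]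
  change ((m.totalRate z.2 / m.totalRate z.2 : ℝ≥0) : ℝ≥0∞) = 1
  rw [div_self h, ENNReal.coe_one]

instance (z : State K M) (a : Action K M) : IsFiniteMeasure (m.jumpLaw z a) := by
  have h1 := fun e => m.isProbabilityMeasure_eventLaw e (afterDecision a z)
  refine ⟨?_⟩
  simp only [jumpLaw, Measure.coe_finsetSum, Finset.sum_apply, Measure.smul_apply, smul_eq_mul,
    measure_univ, mul_one]
  exact ENNReal.sum_lt_top.2 fun e _ => ENNReal.coe_lt_top

lemma measurable_map_prod {α β : Type*} [MeasurableSpace α] [MeasurableSpace β]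
    (t : α → ℝ) (ht : Measurable t) (ν : α → Measure ℝ) (hν : Measurable ν)
    (ρ : α → Measure β) (hρ : Measurable ρ) (C : ℝ≥0∞) (hC : C < ∞)
    (hν1 : ∀ x, ν x univ ≤ C) (hρ1 : ∀ x, ρ x univ ≤ C) :
    Measurable fun x => ((ν x).prod (ρ x)).map
      fun q => (Sum.inl (t x + q.1, q.2) : (ℝ × β) ⊕ Unit) := by
  let κ : Kernel α ℝ := ⟨ν, hν⟩
  let η : Kernel α β := ⟨ρ, hρ⟩
  have : IsFiniteKernel κ := ⟨⟨C, hC, hν1⟩⟩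
  have : IsFiniteKernel η := ⟨⟨C, hC, hρ1⟩⟩
  let ζ := Kernel.map (Kernel.deterministic t ht ×ₖ (κ ×ₖ η))
    fun q => (Sum.inl (q.1 + q.2.1, q.2.2) : (ℝ × β) ⊕ Unit)
  have hm : Measurable fun q : ℝ × ℝ × β => (Sum.inl (q.1 + q.2.1, q.2.2) : (ℝ × β) ⊕ Unit) :=
    measurable_inl.comp (by fun_prop)
  have key : (fun x => ((ν x).prod (ρ x)).map
      fun q => (Sum.inl (t x + q.1, q.2) : (ℝ × β) ⊕ Unit)) = ζ := by
    funext x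
    have h1 : IsFiniteMeasure (ν x) := ⟨(hν1 x).trans_lt hC⟩
    have h2 : IsFiniteMeasure (ρ x) := ⟨(hρ1 x).trans_lt hC⟩
    change _ = (Kernel.map _ _) x
    rw [Kernel.map_apply _ hm, Kernel.prod_apply, Kernel.prod_apply, Kernel.deterministic_apply,
      Measure.dirac_prod, Measure.map_map hm (by fun_prop)]
    rfl
  rw [key]
  exact ζ.measurable

lemma measurable_nextJump (a : Action K M) : Measurable fun p => m.nextJump p a := by
  refine measurable_of_config fun c => ?_
  by_cases h : m.totalRate c = 0
  · simp only [nextJump, h, if_true]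
    exact measurable_const
  · simp only [nextJump, h, if_false]
    have := isProbabilityMeasure_expMeasure (r := m.totalRate c)
      (by exact_mod_cast pos_iff_ne_zero.2 h)
    have h2 := fun r : ℝ × ℝ × ℝ => m.isProbabilityMeasure_jumpLaw (r, c) a h
    exact measurable_map_prod (fun q : ℝ × (ℝ × ℝ × ℝ) => q.1) measurable_fst _ measurable_const
      _ ((m.measurable_jumpLaw a c).comp measurable_snd) 1 (by simp)
      (fun _ => prob_le_one) (fun _ => prob_le_one)

lemma isProbabilityMeasure_nextJump (p : ℝ × State K M) (a : Action K M) :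
    IsProbabilityMeasure (m.nextJump p a) := by
  unfold nextJump
  split_ifs with h
  · infer_instance
  · have := isProbabilityMeasure_expMeasure (r := m.totalRate p.2.2)
      (by exact_mod_cast pos_iff_ne_zero.2 h)
    have := m.isProbabilityMeasure_jumpLaw p.2 a h
    exact Measure.isProbabilityMeasure_map (measurable_inl.comp (by fun_prop)).aemeasurable

lemma integral_density (l : ℝ≥0) (τ : ℝ) :
    ((volume.restrict (Ioc 0 τ)).withDensity fun s =>
      ENNReal.ofReal (l * Real.exp (-(l * s)))) univ
      = ENNReal.ofReal (1 - Real.exp (-(l * max τ 0))) := by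
  rw [withDensity_apply _ MeasurableSet.univ, Measure.restrict_univ]
  rcases le_or_gt τ 0 with h | h
  · simp [h]
  have hc : Continuous fun s : ℝ => (l : ℝ) * Real.exp (-(l * s)) := by fun_prop
  rw [← ofReal_integral_eq_lintegral_ofReal
      (hc.integrableOn_Icc.mono_set Ioc_subset_Icc_self)
      (Filter.Eventually.of_forall fun s => by positivity),
    ← intervalIntegral.integral_of_le h.le, max_eq_left h.le]
  congr 1
  have hd : ∀ s ∈ uIcc 0 τ, HasDerivAt (fun s : ℝ => -Real.exp (-(l * s)))
      (l * Real.exp (-(l * s))) s := by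
    intro s _
    have h1 : HasDerivAt (fun s : ℝ => -((l : ℝ) * s)) (-(l * 1)) s :=
      ((hasDerivAt_id s).const_mul (l : ℝ)).neg
    exact h1.exp.neg.congr_deriv (by ring)
  rw [intervalIntegral.integral_eq_sub_of_hasDerivAt hd (hc.intervalIntegrable _ _)]
  simp
  ring

lemma measurable_mdpLaw (a : Action K M) : Measurable fun p => m.mdpLaw p a := by
  refine measurable_of_config fun c => ?_
  unfold mdpLaw
  have hle : ∀ τ : ℝ, ((volume.restrict (Ioc 0 τ)).withDensity fun s =>
      ENNReal.ofReal (m.totalRate c * Real.exp (-(m.totalRate c * s)))) univ ≤ 1 := by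
    intro τ
    rw [integral_density, ENNReal.ofReal_le_one]
    linarith [Real.exp_pos (-(m.totalRate c * max τ 0))]
  have hν : Measurable fun t : ℝ => (volume.restrict (Ioc 0 (m.T - t))).withDensity fun s =>
      ENNReal.ofReal (m.totalRate c * Real.exp (-(m.totalRate c * s))) := by
    refine Measure.measurable_of_measurable_coe _ fun B hB => ?_
    have : (fun t : ℝ => ((volume.restrict (Ioc 0 (m.T - t))).withDensity fun s =>
        ENNReal.ofReal (m.totalRate c * Real.exp (-(m.totalRate c * s)))) B)
        = fun t => ∫⁻ s, ({q : ℝ × ℝ | q.2 ∈ B ∧ 0 < q.2 ∧ q.2 ≤ m.T - q.1}.indicator (fun q =>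
          ENNReal.ofReal (m.totalRate c * Real.exp (-(m.totalRate c * q.2))))) (t, s) := by
      funext t
      rw [withDensity_apply _ hB, Measure.restrict_restrict hB,
        ← lintegral_indicator (hB.inter measurableSet_Ioc)]
      rfl
    rw [this]
    refine Measurable.lintegral_prod_right' (Measurable.indicator (by fun_prop) ?_)
    exact (measurable_snd hB).inter ((measurableSet_lt measurable_const measurable_snd).inter
      (measurableSet_le measurable_snd (by fun_prop)))
  have hadd : ∀ {F G : ℝ × (ℝ × ℝ × ℝ) → Measure (Node K M)}, Measurable F → Measurable G →
      Measurable fun q => F q + G q := by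
    intro F G hF hG
    refine Measure.measurable_of_measurable_coe _ fun B hB => ?_
    simp only [Measure.add_apply]
    exact ((Measure.measurable_coe hB).comp hF).add ((Measure.measurable_coe hB).comp hG)
  refine hadd ?_ ?_
  · by_cases h : m.totalRate c = 0
    · simp only [h, NNReal.coe_zero, zero_mul, ENNReal.ofReal_zero, withDensity_const, zero_smul,
        Measure.zero_prod, Measure.map_zero]
      exact measurable_const
    · have h2 := fun r : ℝ × ℝ × ℝ => m.isProbabilityMeasure_jumpLaw (r, c) a h
      exact measurable_map_prod (fun q : ℝ × (ℝ × ℝ × ℝ) => q.1) measurable_fst _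
        (hν.comp measurable_fst) _ ((m.measurable_jumpLaw a c).comp measurable_snd) 1 (by simp)
        (fun _ => hle _) (fun _ => prob_le_one)
  · refine Measure.measurable_of_measurable_coe _ fun B hB => ?_
    simp only [Measure.smul_apply, smul_eq_mul]
    exact Measurable.mul_const (by fun_prop) _

lemma isProbabilityMeasure_mdpLaw (p : ℝ × State K M) (a : Action K M) :
    IsProbabilityMeasure (m.mdpLaw p a) := by
  have hm : Measurable fun q : ℝ × State K M => (Sum.inl (p.1 + q.1, q.2) : Node K M) :=
    measurable_inl.comp (by fun_prop)
  refine ⟨?_⟩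
  rw [mdpLaw, Measure.add_apply, Measure.map_apply hm MeasurableSet.univ, preimage_univ,
    ← univ_prod_univ, Measure.prod_prod, integral_density, Measure.smul_apply,
    measure_univ (μ := Measure.dirac _), smul_eq_mul, mul_one]
  have hexp : Real.exp (-(m.totalRate p.2.2 * max (m.T - p.1) 0)) ≤ 1 := by
    rw [Real.exp_le_one_iff]
    have : 0 ≤ max (m.T - p.1) 0 := le_max_right _ _
    have := mul_nonneg (m.totalRate p.2.2).coe_nonneg this
    linarith
  by_cases h : m.totalRate p.2.2 = 0
  · simp [h]
  · have := m.isProbabilityMeasure_jumpLaw p.2 a h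
    rw [measure_univ, mul_one, ← ENNReal.ofReal_add (by linarith) (Real.exp_pos _).le]
    simp

end Model

/-! ### Policies and laws of the chains -/

/-- An admissible (feedback) policy `(f_n)`: the decision taken at the `n`-th jump time `T_n` is
`f_n(T_n, Z_n)`. (Its values at times outside `[0, T]` play no role.) -/
structure Policy (K M : ℕ) where
  rule : ℕ → ℝ × State K M → Action K M
  measurable : ∀ n, Measurable (rule n)
  mem : ∀ n t z, rule n (t, z) ∈ admissible z

namespace Policy

variable {K M : ℕ} (α : Policy K M)

/-- Step `n → n + 1` of the chain obtained from a family of one-step laws; the cemetery is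
absorbing. -/
def step (L : ℝ × State K M → Action K M → Measure (Node K M))
    (hL : ∀ a, Measurable fun p => L p a) (n : ℕ) : Kernel (Node K M) (Node K M) where
  toFun := Sum.elim (fun p => L p (α.rule n p)) fun u => Measure.dirac (Sum.inr u)
  measurable' := by
    refine Measurable.sumElim ?_ (Measure.measurable_dirac.comp measurable_inr)
    have h : Measurable fun q : (ℝ × State K M) × Action K M => L q.1 q.2 :=
      measurable_from_prod_countable_left hL
    exact h.comp (measurable_id.prodMk (α.measurable n))

lemma isMarkovKernel_step (L : ℝ × State K M → Action K M → Measure (Node K M))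
    (hL : ∀ a, Measurable fun p => L p a) (hP : ∀ p a, IsProbabilityMeasure (L p a)) (n : ℕ) :
    IsMarkovKernel (α.step L hL n) := by
  refine ⟨?_⟩
  rintro (p | u)
  · exact hP p _
  · exact (inferInstance : IsProbabilityMeasure (Measure.dirac (Sum.inr u : Node K M)))

/-- Law on the sequences of nodes of the chain that starts at `(t, z)`. -/
def chainLaw (L : ℝ × State K M → Action K M → Measure (Node K M))
    (hL : ∀ a, Measurable fun p => L p a) (hP : ∀ p a, IsProbabilityMeasure (L p a))
    (t : ℝ) (z : State K M) : Measure (ℕ → Node K M) :=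
  haveI := α.isMarkovKernel_step L hL hP
  Kernel.traj (X := fun _ => Node K M)
    (fun n => (α.step L hL n).comap (fun h : (i : Finset.Iic n) → Node K M =>
      h ⟨n, Finset.mem_Iic.2 le_rfl⟩) (measurable_pi_apply _)) 0 (fun _ => Sum.inl (t, z))

end Policy

/-- Expectation of a real random variable as an extended real number, `E[X⁺] - E[X⁻]`; it is the
usual one as soon as one of the two terms is finite. -/
def expectation {Ω : Type*} [MeasurableSpace Ω] (P : Measure Ω) (X : Ω → ℝ) : EReal :=
  ((∫⁻ ω, ENNReal.ofReal (X ω) ∂P : ℝ≥0∞) : EReal)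
    - ((∫⁻ ω, ENNReal.ofReal (-X ω) ∂P : ℝ≥0∞) : EReal)

/-! ### The continuous-time problem -/

/-- Number of arrivals after the initial time and up to time `s`: the largest `n` with `T_n ≤ s`. -/
def arrivals {K M : ℕ} (ω : ℕ → Node K M) (s : ℝ) : ℕ :=
  sSup {n | ∃ p, ω n = Sum.inl p ∧ p.1 ≤ s}

/-- Control and state `(α_s, Z_s)` at time `s`. For `T_n ≤ s < T_{n+1}` the decision
`a = f_n(T_n, Z_n)` is in force and the order book is in state `φ^a(Z_n)`. (The default value is not
used at times after the initial one.) -/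
def current {K M : ℕ} (α : Policy K M) (ω : ℕ → Node K M) (s : ℝ) : Action K M × State K M :=
  match ω (arrivals ω s) with
  | .inl p =>
      (α.rule (arrivals ω s) p, afterDecision (α.rule (arrivals ω s) p) p.2)
  | .inr _ => default

namespace Model

variable {K M : ℕ} (m : Model K M)

/-- The law `P^α_{t,z}` of the jump times and post-jump states of the controlled order book. -/
def law (α : Policy K M) (t : ℝ) (z : State K M) : Measure (ℕ → Node K M) :=
  α.chainLaw m.nextJump m.measurable_nextJump m.isProbabilityMeasure_nextJump t z

/-- Value function of the market-making problem:
`V(t, z) = sup_α E^α_{t,z}[∫_t^T f(α_s, Z_s) ds + g(Z_T)]`. -/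
def value (t : ℝ) (z : State K M) : EReal :=
  ⨆ α : Policy K M, expectation (m.law α t z) fun ω =>
    (∫ s in t..m.T, m.f (current α ω s).1 (current α ω s).2) + m.g (current α ω m.T).2

/-! ### The Markov decision process -/

/-- The law of the chain `(T_n, Z_n)` of the decision process. -/
def mdpChain (α : Policy K M) (t : ℝ) (z : State K M) : Measure (ℕ → Node K M) :=
  α.chainLaw m.mdpLaw m.measurable_mdpLaw m.isProbabilityMeasure_mdpLaw t z

open Classical in
/-- The reward `r(t, z, a)` of one step of the decision process:
`c(z, a) (1 / λ(z) - e^{-λ(z) (T - t)} / λ(z)) + e^{-λ(z) (T - t)} g` for `t ≤ T`, where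
`c(z, a)` is the running reward and `g` the terminal reward in the state `φ^a(z)` held after the
decision; for `λ(z) = 0` the first factor is read as its limit `T - t`. -/
def reward (t : ℝ) (z : State K M) (a : Action K M) : ℝ :=
  let l : ℝ := m.totalRate z.2
  if t ≤ m.T then
    m.f a (afterDecision a z) *
        (if l = 0 then m.T - t else 1 / l - Real.exp (-(l * (m.T - t))) / l)
      + Real.exp (-(l * (m.T - t))) * m.g (afterDecision a z)
  else 0

/-- The reward collected at step `n`; it is zero at the cemetery. -/
def stepReward (α : Policy K M) (ω : ℕ → Node K M) (n : ℕ) : ℝ :=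
  Sum.elim (fun p => m.reward p.1 p.2 (α.rule n p)) (fun _ => 0) (ω n)

/-- Value function of the decision process with infinite horizon:
`V_∞(t, z) = sup_{(f_n)} E[∑_{n ≥ 0} r(T_n, Z_n, f_n(T_n, Z_n))]`. -/
def mdpValue (t : ℝ) (z : State K M) : EReal :=
  ⨆ α : Policy K M, expectation (m.mdpChain α t z) fun ω => ∑' n, m.stepReward α ω n

/-! ### Assumptions -/

/-- The intensities grow at most linearly in the volumes of the book. -/
def LinearIntensities : Prop :=
  ∃ C : ℝ, ∀ (e : Event K) (a b : Fin K → ℕ),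
    (m.intensity e a b : ℝ) ≤ C * (1 + ∑ i, (a i : ℝ) + ∑ i, (b i : ℝ))

/-- Assumption on the rewards for the initial condition `(t, z)`: the expected positive part of the
running reward is bounded uniformly in the policy, and the terminal reward is almost surely at most
of polynomial (for instance linear) growth in the number of arrivals. -/
def RewardBounds (t : ℝ) (z : State K M) : Prop :=
  (⨆ α : Policy K M, ∫⁻ ω, (∫⁻ s in Icc t m.T,
      ENNReal.ofReal (m.f (current α ω s).1 (current α ω s).2)) ∂(m.law α t z)) < ∞ ∧
  ∃ (c : ℝ) (d : ℕ), ∀ α : Policy K M, ∀ᵐ ω ∂(m.law α t z),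
    m.g (current α ω m.T).2 ≤ c * (1 + (arrivals ω m.T : ℝ)) ^ d

end Model

end MarketMaking

end

open MeasureTheory ProbabilityTheory Set
open scoped ENNReal NNReal

noncomputable section

namespace MarketMaking

/-! The suprema agree because each policy earns the same in the two problems. Between two jumps the
control and the book are frozen, so the reward of a trajectory is a sum of rewards of periods
(`hasSum_periodReward`). Given `(T_n, Z_n)`, the waiting time `S` is exponential with rate `λ`. With
`x = T - T_n`, `E[min(S, x)] = (1 - e^{-λx})/λ` and `P(S > x) = e^{-λx}`, so the mean reward of the
period is exactly `r` (`lintegral_periodReward`). The decision process only replaces nodes beyond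
the horizon by the cemetery. Such nodes earn nothing and never lead back below the horizon, so the
marginals on times up to `T` coincide (`lintegral_law_eq_mdpChain`).

It remains to exchange sums and expectations. An arrival raises the largest volume by at most one,
once that bound dominates the boundary volumes; hence `λ(Z_n) ≤ L (n + 1)`. With discount rate `L
k`, the Laplace transform of `T_n` is then at most a constant times `k! n! / (n + k)!`, and `P(T_n ≤
T) = O(n^{-k})` for every `k` (`exists_law_alive_le`). Consequently almost surely finitely many
jumps precede the horizon, and their number has all moments. This controls the positive part of the
terminal reward; that of the running reward is finite by assumption.

The negative parts may have infinite mean. So `f` and `g` are split into positive and negative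
parts, the equality is proved for nonnegative rewards in `ℝ≥0∞`, and `expectation_tsum_sub`
recombines the parts, allowing the value `-∞`. -/

/-! ### Extended expectations -/

/-- The extended expectation of a difference of nonnegative functions, the first of which is
integrable. -/
lemma expectation_eq_sub {Ω : Type*} [MeasurableSpace Ω] {P : Measure Ω} {X : Ω → ℝ}
    {A B : Ω → ℝ} (hA : Measurable A) (hB : Measurable B) (hA0 : ∀ ω, 0 ≤ A ω)
    (hB0 : ∀ ω, 0 ≤ B ω) (hX : ∀ᵐ ω ∂P, X ω = A ω - B ω)
    (hfin : ∫⁻ ω, ENNReal.ofReal (A ω) ∂P ≠ ∞) :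
    expectation P X = ((∫⁻ ω, ENNReal.ofReal (A ω) ∂P : ℝ≥0∞) : EReal)
      - ((∫⁻ ω, ENNReal.ofReal (B ω) ∂P : ℝ≥0∞) : EReal) := by
  have h1 : ∫⁻ ω, ENNReal.ofReal (X ω) ∂P = ∫⁻ ω, ENNReal.ofReal (A ω - B ω) ∂P :=
    lintegral_congr_ae (hX.mono fun ω h => by simp only [h])
  have h2 : ∫⁻ ω, ENNReal.ofReal (-X ω) ∂P = ∫⁻ ω, ENNReal.ofReal (B ω - A ω) ∂P :=
    lintegral_congr_ae (hX.mono fun ω h => by simp only [h, neg_sub])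
  -- Integrated form of the identity `X⁺ + B = X⁻ + A`. As an equation between sums it makes sense
  -- even when some terms are infinite, and `A`, `B` need not be the parts of `X`.
  have key : (∫⁻ ω, ENNReal.ofReal (X ω) ∂P) + ∫⁻ ω, ENNReal.ofReal (B ω) ∂P
      = (∫⁻ ω, ENNReal.ofReal (-X ω) ∂P) + ∫⁻ ω, ENNReal.ofReal (A ω) ∂P := by
    rw [h1, h2, ← lintegral_add_right _ hB.ennreal_ofReal, ← lintegral_add_right _ hA.ennreal_ofReal]
    refine lintegral_congr fun ω => ?_
    rcases le_total (A ω) (B ω) with h | h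
    · rw [ENNReal.ofReal_of_nonpos (sub_nonpos.2 h), zero_add,
        ← ENNReal.ofReal_add (sub_nonneg.2 h) (hA0 ω), sub_add_cancel]
    · rw [ENNReal.ofReal_of_nonpos (sub_nonpos.2 h), zero_add,
        ← ENNReal.ofReal_add (sub_nonneg.2 h) (hB0 ω), sub_add_cancel]
  have hXA : ∫⁻ ω, ENNReal.ofReal (X ω) ∂P ≠ ∞ := by
    refine ne_top_of_le_ne_top hfin ?_
    rw [h1]
    exact lintegral_mono fun ω => ENNReal.ofReal_le_ofReal (sub_le_self _ (hB0 ω))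
  unfold expectation
  generalize (∫⁻ ω, ENNReal.ofReal (X ω) ∂P) = x at *
  generalize (∫⁻ ω, ENNReal.ofReal (-X ω) ∂P) = y at *
  generalize (∫⁻ ω, ENNReal.ofReal (A ω) ∂P) = a at *
  generalize (∫⁻ ω, ENNReal.ofReal (B ω) ∂P) = b at *
  lift x to ℝ≥0 using hXA
  lift a to ℝ≥0 using hfin
  -- If `E[B]` is infinite, so is `E[X⁻]`, and both sides are `-∞`.
  by_cases hb : b = ∞
  · subst hb
    have hy : y = ∞ := by
      by_contra hy
      exact ENNReal.add_ne_top.2 ⟨hy, ENNReal.coe_ne_top⟩ (key.symm.trans (by simp))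
    subst hy
    rfl
  · have hy : y ≠ ∞ := by
      intro hy
      subst hy
      exact ENNReal.add_ne_top.2 ⟨ENNReal.coe_ne_top, hb⟩ (key.trans (by simp))
    lift b to ℝ≥0 using hb
    lift y to ℝ≥0 using hy
    have h : (x : ℝ) + b = y + a := by exact_mod_cast key
    have h' : (x : ℝ) - y = a - b := by linarith
    change ((x : ℝ) : EReal) - ((y : ℝ) : EReal) = ((a : ℝ) : EReal) - ((b : ℝ) : EReal)
    rw [← EReal.coe_sub, h', EReal.coe_sub]

/-- The extended expectation of a series of differences of nonnegative functions with almost surely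
finitely many nonzero terms. -/
lemma expectation_tsum_sub {Ω : Type*} [MeasurableSpace Ω] {P : Measure Ω} {X : Ω → ℝ}
    {a b : ℕ → Ω → ℝ} (ha : ∀ n, Measurable (a n)) (hb : ∀ n, Measurable (b n))
    (ha0 : ∀ n ω, 0 ≤ a n ω) (hb0 : ∀ n ω, 0 ≤ b n ω)
    (hfs : ∀ᵐ ω ∂P, {n | a n ω ≠ 0 ∨ b n ω ≠ 0}.Finite)
    (hX : ∀ᵐ ω ∂P, X ω = ∑' n, (a n ω - b n ω))
    (hfin : ∑' n, ∫⁻ ω, ENNReal.ofReal (a n ω) ∂P ≠ ∞) :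
    expectation P X = ((∑' n, ∫⁻ ω, ENNReal.ofReal (a n ω) ∂P : ℝ≥0∞) : EReal)
      - ((∑' n, ∫⁻ ω, ENNReal.ofReal (b n ω) ∂P : ℝ≥0∞) : EReal) := by
  -- Finite support makes the real series summable, so that its `tsum` is not the default value `0`.
  have hsum : ∀ {c : ℕ → Ω → ℝ}, (∀ n, Measurable (c n)) → (∀ n ω, 0 ≤ c n ω) →
      (∀ᵐ ω ∂P, {n | c n ω ≠ 0}.Finite) →
      ∑' n, ∫⁻ ω, ENNReal.ofReal (c n ω) ∂P = ∫⁻ ω, ENNReal.ofReal (∑' n, c n ω) ∂P := by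
    intro c hc hc0 hcf
    rw [← lintegral_tsum fun n => (hc n).ennreal_ofReal.aemeasurable]
    refine lintegral_congr_ae (hcf.mono fun ω h => ?_)
    exact (ENNReal.ofReal_tsum_of_nonneg (fun n => hc0 n ω)
      (summable_of_hasFiniteSupport h)).symm
  have haf : ∀ᵐ ω ∂P, {n | a n ω ≠ 0}.Finite :=
    hfs.mono fun ω h => h.subset fun n hn => Or.inl hn
  have hbf : ∀ᵐ ω ∂P, {n | b n ω ≠ 0}.Finite :=
    hfs.mono fun ω h => h.subset fun n hn => Or.inr hn
  rw [hsum ha ha0 haf] at hfin ⊢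
  rw [hsum hb hb0 hbf]
  refine expectation_eq_sub (Measurable.tsum ha) (Measurable.tsum hb)
    (fun ω => tsum_nonneg fun n => ha0 n ω) (fun ω => tsum_nonneg fun n => hb0 n ω) ?_ hfin
  filter_upwards [hX, haf, hbf] with ω h1 h2 h3
  rw [h1]
  exact Summable.tsum_sub (summable_of_hasFiniteSupport h2) (summable_of_hasFiniteSupport h3)

/-! ### Marginals of the chains -/

namespace Policy

variable {K M : ℕ} (α : Policy K M) (L : ℝ × State K M → Action K M → Measure (Node K M))
    (hL : ∀ a, Measurable fun p => L p a) (hP : ∀ p a, IsProbabilityMeasure (L p a))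
    (t : ℝ) (z : State K M)

lemma isProbabilityMeasure_chainLaw : IsProbabilityMeasure (α.chainLaw L hL hP t z) := by
  unfold chainLaw
  infer_instance

lemma chainLaw_zero : ∀ᵐ ω ∂(α.chainLaw L hL hP t z), ω 0 = Sum.inl (t, z) := by
  have := α.isMarkovKernel_step L hL hP
  have h := Kernel.traj_map_frestrictLe_apply (X := fun _ => Node K M)
    (κ := fun n => (α.step L hL n).comap (fun h : (i : Finset.Iic n) → Node K M =>
      h ⟨n, Finset.mem_Iic.2 le_rfl⟩) (measurable_pi_apply _)) 0 0 (fun _ => Sum.inl (t, z))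
  rw [Kernel.partialTraj_self, Kernel.id_apply] at h
  have h1 : ∀ᵐ x ∂(Measure.dirac (fun _ => Sum.inl (t, z)) :
      Measure ((i : Finset.Iic 0) → Node K M)), x ⟨0, Finset.mem_Iic.2 le_rfl⟩ = Sum.inl (t, z) := by
    rw [ae_dirac_iff]
    have hs : MeasurableSet ({Sum.inl (t, z)} : Set (Node K M)) := by
      rw [← image_singleton]
      exact (measurableSet_singleton _).inl_image
    have hm : Measurable fun x : (i : Finset.Iic 0) → Node K M =>
        x ⟨0, Finset.mem_Iic.2 le_rfl⟩ := measurable_pi_apply _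
    exact hm hs
  rw [← h] at h1
  exact ae_of_ae_map (by fun_prop) h1

/-- The Markov property in integrated form: the kernel of `Kernel.traj` at time `n` looks at the
history only through its last entry, so `ω (n + 1)` can be integrated out given `ω n`. -/
lemma lintegral_chainLaw_pair (n : ℕ) {H : Node K M × Node K M → ℝ≥0∞} (hH : Measurable H) :
    ∫⁻ ω, H (ω n, ω (n + 1)) ∂(α.chainLaw L hL hP t z)
      = ∫⁻ ω, ∫⁻ y, H (ω n, y) ∂(α.step L hL n (ω n)) ∂(α.chainLaw L hL hP t z) := by
  have := α.isMarkovKernel_step L hL hP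
  let κ : (n : ℕ) → Kernel ((i : Finset.Iic n) → Node K M) (Node K M) := fun n =>
    (α.step L hL n).comap (fun h : (i : Finset.Iic n) → Node K M =>
      h ⟨n, Finset.mem_Iic.2 le_rfl⟩) (measurable_pi_apply _)
  have h := Kernel.partialTraj_compProd_eq_map_traj (X := fun _ => Node K M) (κ := κ)
    (Nat.zero_le n) (x₀ := fun _ => Sum.inl (t, z))
  have h0 := Kernel.traj_map_frestrictLe_apply (X := fun _ => Node K M) (κ := κ) 0 n
    (fun _ => Sum.inl (t, z))
  have hG : Measurable fun q : ((i : Finset.Iic n) → Node K M) × Node K M =>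
      H (q.1 ⟨n, Finset.mem_Iic.2 le_rfl⟩, q.2) := by fun_prop
  have e1 : ∫⁻ ω, H (ω n, ω (n + 1)) ∂(α.chainLaw L hL hP t z)
      = ∫⁻ q, H (q.1 ⟨n, Finset.mem_Iic.2 le_rfl⟩, q.2)
        ∂((α.chainLaw L hL hP t z).map fun x => (Preorder.frestrictLe n x, x (n + 1))) := by
    rw [lintegral_map hG (by fun_prop)]
    rfl
  rw [e1]
  change ∫⁻ q, _ ∂((Kernel.traj (X := fun _ => Node K M) κ 0 fun _ => Sum.inl (t, z)).map _) = _
  rw [← h, Measure.lintegral_compProd hG, ← h0, lintegral_map hG.lintegral_kernel_prod_right'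
    (by fun_prop)]
  rfl

lemma lintegral_chainLaw_succ (n : ℕ) {H : Node K M → ℝ≥0∞} (hH : Measurable H) :
    ∫⁻ ω, H (ω (n + 1)) ∂(α.chainLaw L hL hP t z)
      = ∫⁻ ω, ∫⁻ y, H y ∂(α.step L hL n (ω n)) ∂(α.chainLaw L hL hP t z) :=
  α.lintegral_chainLaw_pair L hL hP t z n (hH.comp measurable_snd)

/-- A relation which holds almost surely between a node and its successor under the one-step laws
holds almost surely along the chain. -/
lemma ae_chainLaw_pair {R : ℕ → Set (Node K M × Node K M)} (hR : ∀ n, MeasurableSet (R n))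
    (h : ∀ n p, ∀ᵐ y ∂(L p (α.rule n p)), (Sum.inl p, y) ∈ R n)
    (h' : ∀ n u, (Sum.inr u, Sum.inr u) ∈ R n) :
    ∀ᵐ ω ∂(α.chainLaw L hL hP t z), ∀ n, (ω n, ω (n + 1)) ∈ R n := by
  rw [ae_all_iff]
  intro n
  have e := α.lintegral_chainLaw_pair L hL hP t z n
    (H := (R n)ᶜ.indicator 1) (measurable_one.indicator (hR n).compl)
  have hz : ∫⁻ ω, (R n)ᶜ.indicator 1 (ω n, ω (n + 1)) ∂(α.chainLaw L hL hP t z) = 0 := by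
    rw [e]
    refine (lintegral_congr fun ω => ?_).trans lintegral_zero
    have hae : ∀ᵐ y ∂(α.step L hL n (ω n)), (ω n, y) ∈ R n := by
      rcases ω n with p | u
      · exact h n p
      · change ∀ᵐ y ∂(Measure.dirac (Sum.inr u)), _
        rw [ae_dirac_iff (measurable_prodMk_left (hR n))]
        exact h' n u
    refine (lintegral_congr_ae (hae.mono fun y hy => ?_)).trans lintegral_zero
    simp [hy]
  have hm : Measurable fun ω : ℕ → Node K M =>
      ((R n)ᶜ.indicator 1 : Node K M × Node K M → ℝ≥0∞) (ω n, ω (n + 1)) :=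
    (measurable_one.indicator (hR n).compl).comp (by fun_prop)
  rw [lintegral_eq_zero_iff hm] at hz
  filter_upwards [hz] with ω hω
  by_contra hn
  simp [hn] at hω

end Policy

/-! ### Integrals with respect to exponential laws -/

lemma lintegral_expMeasure (r : ℝ) (H : ℝ → ℝ≥0∞) (hH : Measurable H) :
    ∫⁻ s, H s ∂(expMeasure r) = ∫⁻ s, exponentialPDF r s * H s := by
  have hm : Measurable (exponentialPDF r) := (measurable_exponentialPDFReal r).ennreal_ofReal
  exact lintegral_withDensity_eq_lintegral_mul _ hm hH

/-- The bridge between the waiting time of `nextJump` and the truncated density that defines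
`mdpLaw`. -/
lemma setLIntegral_expMeasure_Iic (r x : ℝ) (H : ℝ → ℝ≥0∞) (hH : Measurable H) :
    ∫⁻ s in Iic x, H s ∂(expMeasure r)
      = ∫⁻ s, H s ∂((volume.restrict (Ioc 0 x)).withDensity fun s =>
          ENNReal.ofReal (r * Real.exp (-(r * s)))) := by
  rw [lintegral_withDensity_eq_lintegral_mul _ (by fun_prop) hH, ← lintegral_indicator
    measurableSet_Iic, lintegral_expMeasure _ _ (hH.indicator measurableSet_Iic),
    ← lintegral_indicator measurableSet_Ioc]
  refine lintegral_congr_ae ?_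
  -- The point `0` is discarded: the exponential density is positive there when `r > 0`, whereas
  -- `Ioc 0 x` omits it.
  filter_upwards [compl_mem_ae_iff.2 (measure_singleton (0 : ℝ))] with s hs
  rcases lt_trichotomy s 0 with h | h | h
  · rw [exponentialPDF_of_neg h, zero_mul, indicator_of_notMem (fun h' => h.not_ge h'.1.le)]
  · exact absurd h hs
  · rw [exponentialPDF_of_nonneg h.le]
    by_cases hx : s ≤ x
    · rw [indicator_of_mem (show s ∈ Iic x from hx), indicator_of_mem (show s ∈ Ioc 0 x from ⟨h, hx⟩)]
      rfl
    · rw [indicator_of_notMem (show s ∉ Iic x from hx),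
        indicator_of_notMem (fun h' : s ∈ Ioc 0 x => hx h'.2), mul_zero]

lemma ae_nonneg_expMeasure (r : ℝ) : ∀ᵐ s ∂(expMeasure r), 0 ≤ s := by
  have h : ∫⁻ s, (Iio (0 : ℝ)).indicator 1 s ∂(expMeasure r) = 0 := by
    rw [lintegral_expMeasure _ _ (measurable_one.indicator measurableSet_Iio)]
    refine (lintegral_congr fun s => ?_).trans lintegral_zero
    by_cases hs : s < 0
    · rw [exponentialPDF_of_neg hs, zero_mul]
    · rw [indicator_of_notMem (show s ∉ Iio 0 from hs), mul_zero]
  rw [lintegral_indicator_one measurableSet_Iio] at h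
  filter_upwards [compl_mem_ae_iff.2 h] with s hs
  exact not_lt.1 hs

/-- Laplace transform of the exponential law. -/
lemma laplace_expMeasure {r s : ℝ} (hr : 0 < r) (hs : 0 ≤ s) :
    ∫⁻ u, ENNReal.ofReal (Real.exp (-(s * u))) ∂(expMeasure r) = ENNReal.ofReal (r / (r + s)) := by
  have hrs : 0 < r + s := by linarith
  rw [lintegral_expMeasure _ _ (by fun_prop)]
  -- Exponential tilting: the factor `e^{-su}` turns the density of rate `r` into `r / (r + s)`
  -- times the density of rate `r + s`.
  have : ∀ u, exponentialPDF r u * ENNReal.ofReal (Real.exp (-(s * u)))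
      = ENNReal.ofReal (r / (r + s)) * exponentialPDF (r + s) u := by
    intro u
    rw [exponentialPDF_eq, exponentialPDF_eq]
    split_ifs with hu
    · rw [← ENNReal.ofReal_mul (by positivity), ← ENNReal.ofReal_mul (by positivity)]
      congr 1
      rw [mul_assoc, ← Real.exp_add]
      field_simp
      congr 1
      ring
    · simp
  have hm : Measurable (exponentialPDF (r + s)) :=
    (measurable_exponentialPDFReal _).ennreal_ofReal
  simp_rw [this]
  rw [lintegral_const_mul _ hm,
    lintegral_exponentialPDF_eq_one hrs, mul_one]

lemma expMeasure_Ioi {r x : ℝ} (hr : 0 < r) (hx : 0 ≤ x) :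
    expMeasure r (Ioi x) = ENNReal.ofReal (Real.exp (-(r * x))) := by
  have := isProbabilityMeasure_expMeasure hr
  have h := setLIntegral_expMeasure_Iic r x 1 measurable_one
  simp only [Pi.one_apply, lintegral_one, Measure.restrict_apply MeasurableSet.univ,
    univ_inter] at h
  have h2 := Model.integral_density r.toNNReal x
  rw [Real.coe_toNNReal _ hr.le, max_eq_left hx] at h2
  rw [h2] at h
  rw [← compl_Iic, prob_compl_eq_one_sub measurableSet_Iic, h, ← ENNReal.ofReal_one,
    ← ENNReal.ofReal_sub _ (by
      rw [sub_nonneg, Real.exp_le_one_iff]; have := mul_nonneg hr.le hx; linarith)]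
  congr 1
  ring

/-- Mean of a reward paid at rate `φ` up to an exponential time, truncated at `x`, with the bonus `γ`
if that time exceeds `x`. -/
lemma lintegral_expMeasure_reward {r x φ γ : ℝ} (hr : 0 < r) (hx : 0 ≤ x) (hφ : 0 ≤ φ) (hγ : 0 ≤ γ) :
    ∫⁻ s, ENNReal.ofReal (φ * min s x + if s ≤ x then 0 else γ) ∂(expMeasure r)
      = ENNReal.ofReal (φ * (1 / r - Real.exp (-(r * x)) / r) + Real.exp (-(r * x)) * γ) := by
  have hmeas : Measurable fun s : ℝ => ENNReal.ofReal (φ * min s x + if s ≤ x then 0 else γ) := by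
    refine Measurable.ennreal_ofReal (Measurable.add (by fun_prop) ?_)
    exact Measurable.ite measurableSet_Iic measurable_const measurable_const
  have hexp : 1 + r * x ≤ Real.exp (r * x) := by linarith [Real.add_one_le_exp (r * x)]
  -- This gives `h3`, the nonnegativity of the contribution of `s ≤ x`, without which
  -- `ENNReal.ofReal` would not be additive.
  have hle : Real.exp (-(r * x)) * (1 + r * x) ≤ 1 := by
    rw [Real.exp_neg, inv_mul_le_iff₀ (Real.exp_pos _)]
    linarith
  rw [← lintegral_add_compl _ (measurableSet_Iic (a := x)), compl_Iic,
    setLIntegral_expMeasure_Iic _ _ _ hmeas,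
    lintegral_withDensity_eq_lintegral_mul _ (by fun_prop) hmeas]
  have h2 : ∫⁻ s in Ioi x, ENNReal.ofReal (φ * min s x + if s ≤ x then 0 else γ) ∂(expMeasure r)
      = ENNReal.ofReal ((φ * x + γ) * Real.exp (-(r * x))) := by
    rw [setLIntegral_congr_fun (g := fun _ => ENNReal.ofReal (φ * x + γ)) measurableSet_Ioi
      fun s hs => by
        simp only [mem_Ioi] at hs
        simp only [min_eq_right hs.le, not_le.2 hs, if_false],
      setLIntegral_const, expMeasure_Ioi hr hx, ← ENNReal.ofReal_mul (by positivity)]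
  have hc : Continuous fun s : ℝ => r * Real.exp (-(r * s)) * (φ * s) := by fun_prop
  have h1 : ∫⁻ s in Ioc 0 x, ((fun s => ENNReal.ofReal (r * Real.exp (-(r * s)))) *
        fun s => ENNReal.ofReal (φ * min s x + if s ≤ x then 0 else γ)) s
      = ENNReal.ofReal (φ * (1 / r - (x + 1 / r) * Real.exp (-(r * x)))) := by
    rw [setLIntegral_congr_fun
        (g := fun s => ENNReal.ofReal (r * Real.exp (-(r * s)) * (φ * s))) measurableSet_Ioc
        fun s hs => by
          simp only [Pi.mul_apply, min_eq_left hs.2, hs.2, if_true, add_zero]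
          rw [← ENNReal.ofReal_mul (by positivity)],
      ← ofReal_integral_eq_lintegral_ofReal (hc.integrableOn_Icc.mono_set Ioc_subset_Icc_self)
        ((ae_restrict_iff' measurableSet_Ioc).2 (Filter.Eventually.of_forall fun s hs => by
          have := hs.1.le
          simp only [Pi.zero_apply]
          positivity)),
      ← intervalIntegral.integral_of_le hx]
    congr 1
    have hd : ∀ s ∈ uIcc 0 x, HasDerivAt
        (fun s : ℝ => -(φ * ((s + 1 / r) * Real.exp (-(r * s)))))
        (r * Real.exp (-(r * s)) * (φ * s)) s := by
      intro s _
      have d1 : HasDerivAt (fun s : ℝ => -(r * s)) (-(r * 1)) s :=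
        ((hasDerivAt_id s).const_mul r).neg
      have d2 : HasDerivAt (fun s : ℝ => s + 1 / r) 1 s := (hasDerivAt_id s).add_const _
      refine ((d2.mul d1.exp).const_mul φ).neg.congr_deriv ?_
      field_simp
      ring
    rw [intervalIntegral.integral_eq_sub_of_hasDerivAt hd (hc.intervalIntegrable _ _)]
    simp
    ring
  have h3 : 0 ≤ 1 / r - (x + 1 / r) * Real.exp (-(r * x)) := by
    have : 1 / r - (x + 1 / r) * Real.exp (-(r * x))
        = (1 - Real.exp (-(r * x)) * (1 + r * x)) / r := by
      field_simp
      ring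
    rw [this]
    exact div_nonneg (by linarith) hr.le
  rw [h1, h2, ← ENNReal.ofReal_add (by positivity) (by positivity)]
  congr 1
  field_simp
  ring

/-! ### Growth of the book -/

/-- No limit of the book holds more than `V` orders of general participants. -/
def Config.VolLE {K M : ℕ} (c : Config K M) (V : ℕ) : Prop :=
  ∀ i, c.ask.vol i ≤ V ∧ c.bid.vol i ≤ V

lemma Side.shift_vol_le {K M : ℕ} (s : Side K M) (d : ℤ) {vInf V : ℕ} (hInf : vInf ≤ V)
    (h : ∀ i, s.vol i ≤ V) (i : Fin K) : (s.shift d vInf).vol i ≤ V := by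
  simp only [Side.shift]
  split_ifs
  · exact Nat.zero_le _
  · exact h _
  · exact hInf

namespace Model

variable {K M : ℕ} (m : Model K M)

lemma volLE_setAsk {z : State K M} {s : Side K M} {V : ℕ} (hb : m.bidInf ≤ V)
    (hz : ∀ i, z.2.bid.vol i ≤ V) (hs : ∀ i, s.vol i ≤ V) : (m.setAsk z s).2.VolLE V :=
  fun i => ⟨hs i, Side.shift_vol_le _ _ hb hz i⟩

lemma volLE_setBid {z : State K M} {s : Side K M} {V : ℕ} (ha : m.askInf ≤ V)
    (hz : ∀ i, z.2.ask.vol i ≤ V) (hs : ∀ i, s.vol i ≤ V) : (m.setBid z s).2.VolLE V :=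
  fun i => ⟨Side.shift_vol_le _ _ ha hz i, hs i⟩

/-- Only a limit order raises a volume, and by one. Re-indexing moves volumes and inserts `0` or a
boundary volume. Bounding each limit separately, with `V` above the boundary volumes, makes
re-indexing free of charge. -/
lemma volLE_outcome (e : Event K) (k : ℕ) {z : State K M} {V : ℕ} (ha : m.askInf ≤ V)
    (hb : m.bidInf ≤ V) (hz : z.2.VolLE V) : (m.outcome e k z).2.VolLE (V + 1) := by
  classical
  have h1 : ∀ i, z.2.ask.vol i ≤ V + 1 := fun i => (hz i).1.trans (Nat.le_succ V)
  have h2 : ∀ i, z.2.bid.vol i ≤ V + 1 := fun i => (hz i).2.trans (Nat.le_succ V)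
  have upd : ∀ (v : Fin K → ℕ) (j : Fin K) (x : ℕ), (∀ i, v i ≤ V + 1) → x ≤ V + 1 →
      ∀ i, Function.update v j x i ≤ V + 1 := by
    intro v j x hv hx i
    rcases eq_or_ne i j with rfl | hij
    · simpa using hx
    · simpa [hij] using hv i
  have exe : ∀ s : Side K M, (∀ i, s.vol i ≤ V + 1) → ∀ i, s.execute.vol i ≤ V + 1 := by
    intro s hs i
    simp only [Side.execute]
    split_ifs
    · exact (Nat.sub_le _ _).trans (hs i)
    · exact hs i
  cases e with
  | marketBuy =>
    refine m.volLE_setAsk (hb.trans V.le_succ) ?_ (exe _ h1)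
    split_ifs
    · exact h2
    · exact h2
  | marketSell =>
    refine m.volLE_setBid (ha.trans V.le_succ) ?_ (exe _ h2)
    split_ifs
    · exact h1
    · exact h1
  | limitAsk i =>
    exact m.volLE_setAsk (hb.trans V.le_succ) h2 (upd _ _ _ h1 (Nat.succ_le_succ (hz i).1))
  | limitBid i =>
    exact m.volLE_setBid (ha.trans V.le_succ) h1 (upd _ _ _ h2 (Nat.succ_le_succ (hz i).2))
  | cancelAsk i =>
    exact m.volLE_setAsk (hb.trans V.le_succ) h2 (upd _ _ _ h1 ((Nat.sub_le _ _).trans (h1 i)))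
  | cancelBid i =>
    exact m.volLE_setBid (ha.trans V.le_succ) h1 (upd _ _ _ h2 ((Nat.sub_le _ _).trans (h2 i)))

/-- The book `c'` can follow the book `c` as far as growth is concerned. -/
def Grows (c c' : Config K M) : Prop :=
  ∀ V, m.askInf ≤ V → m.bidInf ≤ V → c.VolLE V → c'.VolLE (V + 1)

lemma ae_jumpLaw_grows (z : State K M) (a : Action K M) :
    ∀ᵐ z' ∂(m.jumpLaw z a), m.Grows z.2 z'.2 := by
  have hs : MeasurableSet {z' : State K M | ¬ m.Grows z.2 z'.2} :=
    measurable_snd (MeasurableSet.of_discrete (s := {c | ¬ m.Grows z.2 c}))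
  rw [ae_iff]
  simp only [jumpLaw, eventLaw, Measure.coe_finsetSum, Finset.sum_apply, Measure.smul_apply,
    smul_eq_mul]
  refine Finset.sum_eq_zero fun e _ => mul_eq_zero_of_right _ (Finset.sum_eq_zero fun k _ =>
    mul_eq_zero_of_right _ ?_)
  rw [Measure.dirac_apply' _ hs, indicator_of_notMem]
  intro hn
  -- A decision leaves the volumes of general participants unchanged, so `hz` also serves for
  -- `afterDecision a z`.
  exact hn fun V ha hb hz => m.volLE_outcome e k ha hb (z := afterDecision a z) hz

/-- Linear bound on the intensity along the chain. -/
lemma exists_totalRate_le (h : m.LinearIntensities) (V : ℕ) : ∃ L : ℝ, 0 < L ∧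
    ∀ (n : ℕ) (c : Config K M), c.VolLE (V + n) → (m.totalRate c : ℝ) ≤ L * (n + 1) := by
  obtain ⟨C, hC⟩ := h
  -- From `1 + 2K(V + n) ≤ (1 + 2K(V + 1))(n + 1)`, summed over the kinds of orders. The last `+ 1`
  -- makes `L` positive.
  refine ⟨(Fintype.card (Event K) : ℝ) * (|C| * (1 + 2 * K * (V + 1))) + 1, by positivity, ?_⟩
  intro n c hc
  have hsum : ∀ v : Fin K → ℕ, (∀ i, v i ≤ V + n) → ∑ i, (v i : ℝ) ≤ K * (V + n) := by
    intro v hv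
    calc ∑ i, (v i : ℝ) ≤ ∑ _i : Fin K, ((V : ℝ) + n) :=
          Finset.sum_le_sum fun i _ => by exact_mod_cast hv i
      _ = K * (V + n) := by simp [mul_add]
  have h1 := hsum c.ask.vol fun i => (hc i).1
  have h2 := hsum c.bid.vol fun i => (hc i).2
  have h3 : ∀ v : Fin K → ℕ, 0 ≤ ∑ i, (v i : ℝ) := fun v => Finset.sum_nonneg fun i _ => by positivity
  have hK : (0 : ℝ) ≤ K := Nat.cast_nonneg _
  have hV : (0 : ℝ) ≤ V := Nat.cast_nonneg _
  have hn : (0 : ℝ) ≤ n := Nat.cast_nonneg _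
  have hVn : (V : ℝ) + n ≤ (V + 1) * (n + 1) := by nlinarith
  have h4 : 1 + ∑ i, (c.ask.vol i : ℝ) + ∑ i, (c.bid.vol i : ℝ)
      ≤ (1 + 2 * K * (V + 1)) * (n + 1) := by
    have := mul_le_mul_of_nonneg_left hVn hK
    linarith
  have h5 : ∀ e, (m.rate e c : ℝ) ≤ |C| * (1 + 2 * K * (V + 1)) * (n + 1) := by
    intro e
    refine (hC e c.ask.vol c.bid.vol).trans ?_
    rw [mul_assoc]
    refine (mul_le_mul_of_nonneg_right (le_abs_self C) ?_).trans
      (mul_le_mul_of_nonneg_left h4 (abs_nonneg C))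
    linarith [h3 c.ask.vol, h3 c.bid.vol]
  have h6 : (m.totalRate c : ℝ)
      ≤ Fintype.card (Event K) * (|C| * (1 + 2 * K * (V + 1)) * (n + 1)) := by
    rw [totalRate, NNReal.coe_sum]
    refine (Finset.sum_le_sum fun e _ => h5 e).trans ?_
    simp
  linarith

end Model

/-! ### Nodes -/

lemma measurable_sum_prod {A B C D : Type*} [MeasurableSpace A] [MeasurableSpace B]
    [MeasurableSpace C] [MeasurableSpace D] {F : (A ⊕ B) × C → D}
    (h1 : Measurable fun q : A × C => F (Sum.inl q.1, q.2))
    (h2 : Measurable fun q : B × C => F (Sum.inr q.1, q.2)) : Measurable F := by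
  have h : Measurable (F ∘ (MeasurableEquiv.sumProdDistrib A B C).symm) := measurable_fun_sum h1 h2
  convert h.comp (MeasurableEquiv.sumProdDistrib A B C).measurable using 1
  funext q
  simp

/-- The nodes with a jump time up to `s`. -/
def alive {K M : ℕ} (s : ℝ) : Set (Node K M) := Sum.inl '' {p | p.1 ≤ s}

section

variable {K M : ℕ}

@[simp] lemma inl_mem_alive {s : ℝ} {p : ℝ × State K M} :
    (Sum.inl p : Node K M) ∈ alive s ↔ p.1 ≤ s := by simp [alive]

@[simp] lemma inr_notMem_alive {s : ℝ} {u : Unit} : (Sum.inr u : Node K M) ∉ alive s := by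
  simp [alive]

lemma measurableSet_alive (s : ℝ) : MeasurableSet (alive s : Set (Node K M)) :=
  (measurableSet_le measurable_fst measurable_const).inl_image

/-- The end, truncated at `T`, of the period that precedes a node. -/
def endTime (T : ℝ) : Node K M → ℝ := Sum.elim (fun q => min q.1 T) fun _ => T

lemma measurable_endTime (T : ℝ) : Measurable (endTime T : Node K M → ℝ) :=
  Measurable.sumElim (by fun_prop) measurable_const

lemma measurable_afterDecision (a : Action K M) : Measurable (afterDecision a : State K M → _) := by
  unfold afterDecision
  exact measurable_fst.prodMk ((Measurable.of_discrete (f := fun c : Config K M =>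
    ({ c with ask := c.ask.place a.ask, bid := c.bid.place a.bid } : Config K M))).comp
      measurable_snd)

/-- There are countably many actions, so measurability for each fixed action is enough for joint
measurability. -/
lemma Policy.measurable_comp_rule {β : Type*} [MeasurableSpace β] (α : Policy K M) (n : ℕ)
    {F : Action K M → ℝ × State K M → β} (hF : ∀ a, Measurable (F a)) :
    Measurable fun p => F (α.rule n p) p := by
  have h : Measurable fun q : (ℝ × State K M) × Action K M => F q.2 q.1 :=
    measurable_from_prod_countable_left hF
  exact h.comp (measurable_id.prodMk (α.measurable n))

end

namespace Model

variable {K M : ℕ} (m : Model K M)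

/-! ### Comparison of the one-step laws -/

lemma lintegral_nextJump {p : ℝ × State K M} {a : Action K M} (h : m.totalRate p.2.2 ≠ 0)
    {H : Node K M → ℝ≥0∞} (hH : Measurable H) :
    ∫⁻ y, H y ∂(m.nextJump p a)
      = ∫⁻ s, ∫⁻ z, H (Sum.inl (p.1 + s, z)) ∂(m.jumpLaw p.2 a) ∂(expMeasure (m.totalRate p.2.2)) := by
  have hm : Measurable fun q : ℝ × State K M => (Sum.inl (p.1 + q.1, q.2) : Node K M) :=
    measurable_inl.comp (by fun_prop)
  rw [nextJump, if_neg h, lintegral_map hH hm]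
  exact lintegral_prod _ (hH.comp hm).aemeasurable

lemma nextJump_of_totalRate_eq_zero {p : ℝ × State K M} (a : Action K M)
    (h : m.totalRate p.2.2 = 0) : m.nextJump p a = Measure.dirac (Sum.inr ()) := by
  rw [nextJump, if_pos h]

lemma lintegral_mdpLaw (p : ℝ × State K M) (a : Action K M) {H : Node K M → ℝ≥0∞}
    (hH : Measurable H) (h0 : H (Sum.inr ()) = 0) :
    ∫⁻ y, H y ∂(m.mdpLaw p a) = ∫⁻ s, ∫⁻ z, H (Sum.inl (p.1 + s, z)) ∂(m.jumpLaw p.2 a)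
      ∂((volume.restrict (Ioc 0 (m.T - p.1))).withDensity fun s =>
        ENNReal.ofReal (m.totalRate p.2.2 * Real.exp (-(m.totalRate p.2.2 * s)))) := by
  have hm : Measurable fun q : ℝ × State K M => (Sum.inl (p.1 + q.1, q.2) : Node K M) :=
    measurable_inl.comp (by fun_prop)
  rw [mdpLaw, lintegral_add_measure, lintegral_smul_measure, lintegral_dirac' _ hH, h0, smul_zero,
    add_zero, lintegral_map hH hm]
  exact lintegral_prod _ (hH.comp hm).aemeasurable

/-- The two one-step laws coincide up to the horizon. -/
lemma lintegral_mdpLaw_eq_nextJump (p : ℝ × State K M) (a : Action K M) {H : Node K M → ℝ≥0∞}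
    (hH : Measurable H) (h0 : ∀ x ∉ alive m.T, H x = 0) :
    ∫⁻ y, H y ∂(m.mdpLaw p a) = ∫⁻ y, H y ∂(m.nextJump p a) := by
  rw [m.lintegral_mdpLaw p a hH (h0 _ (by simp))]
  -- At rate zero neither law charges `alive m.T`: the density vanishes on one side, the cemetery is
  -- reached on the other.
  by_cases h : m.totalRate p.2.2 = 0
  · rw [m.nextJump_of_totalRate_eq_zero a h, lintegral_dirac' _ hH, h0 _ (by simp)]
    simp [h]
  · have hG : Measurable fun s : ℝ => ∫⁻ z, H (Sum.inl (p.1 + s, z)) ∂(m.jumpLaw p.2 a) :=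
      Measurable.lintegral_prod_right' (f := fun q : ℝ × State K M => H (Sum.inl (p.1 + q.1, q.2)))
        (hH.comp (measurable_inl.comp (by fun_prop)))
    rw [m.lintegral_nextJump h hH, ← setLIntegral_expMeasure_Iic _ _ _ hG,
      ← lintegral_indicator measurableSet_Iic]
    refine lintegral_congr fun s => ?_
    by_cases hs : s ≤ m.T - p.1
    · rw [indicator_of_mem (show s ∈ Iic _ from hs)]
    · rw [indicator_of_notMem (show s ∉ Iic _ from hs)]
      refine ((lintegral_congr fun z => h0 _ ?_).trans lintegral_zero).symm
      rw [inl_mem_alive]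
      intro h'
      exact hs (by linarith)

/-- Beyond the horizon the interval of admissible waiting times is empty, so all the mass sits at
the cemetery. This keeps test functions zero outside `alive m.T` when a step is integrated out. -/
lemma lintegral_mdpLaw_of_lt {p : ℝ × State K M} (hp : m.T < p.1) (a : Action K M)
    {H : Node K M → ℝ≥0∞} (hH : Measurable H) (h0 : H (Sum.inr ()) = 0) :
    ∫⁻ y, H y ∂(m.mdpLaw p a) = 0 := by
  rw [m.lintegral_mdpLaw p a hH h0, Ioc_eq_empty (by linarith)]
  simp

/-- Up to the horizon the marginals of the two chains coincide. -/
lemma lintegral_law_eq_mdpChain (α : Policy K M) (t : ℝ) (z : State K M) (n : ℕ) :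
    ∀ {H : Node K M → ℝ≥0∞}, Measurable H → (∀ x ∉ alive m.T, H x = 0) →
      ∫⁻ ω, H (ω n) ∂(m.law α t z) = ∫⁻ ω, H (ω n) ∂(m.mdpChain α t z) := by
  have := α.isProbabilityMeasure_chainLaw m.nextJump m.measurable_nextJump
    m.isProbabilityMeasure_nextJump t z
  have := α.isProbabilityMeasure_chainLaw m.mdpLaw m.measurable_mdpLaw
    m.isProbabilityMeasure_mdpLaw t z
  induction n with
  | zero =>
    intro H _ _
    have h1 := α.chainLaw_zero m.nextJump m.measurable_nextJump m.isProbabilityMeasure_nextJump t z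
    have h2 := α.chainLaw_zero m.mdpLaw m.measurable_mdpLaw m.isProbabilityMeasure_mdpLaw t z
    unfold law mdpChain
    rw [lintegral_congr_ae (h1.mono fun ω h => congrArg H h),
      lintegral_congr_ae (h2.mono fun ω h => congrArg H h)]
    simp
  | succ n ih =>
    intro H hH h0
    have e1 := α.lintegral_chainLaw_succ m.nextJump m.measurable_nextJump
      m.isProbabilityMeasure_nextJump t z n hH
    have e2 := α.lintegral_chainLaw_succ m.mdpLaw m.measurable_mdpLaw
      m.isProbabilityMeasure_mdpLaw t z n hH
    have hstep : ∀ x, ∫⁻ y, H y ∂(α.step m.mdpLaw m.measurable_mdpLaw n x)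
        = ∫⁻ y, H y ∂(α.step m.nextJump m.measurable_nextJump n x) := by
      rintro (p | u)
      · exact m.lintegral_mdpLaw_eq_nextJump p _ hH h0
      · rfl
    unfold law mdpChain
    rw [e1, e2]
    simp_rw [hstep]
    -- The induction hypothesis is applied to the one-step integral of `H`, which must again vanish
    -- outside `alive m.T`. Rewriting it with `mdpLaw` makes this immediate.
    refine ih hH.lintegral_kernel fun x hx => ?_
    rw [← hstep]
    rcases x with p | u
    · exact m.lintegral_mdpLaw_of_lt (by simpa using hx) _ hH (h0 _ (by simp))
    · change ∫⁻ y, H y ∂(Measure.dirac (Sum.inr u)) = 0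
      rw [lintegral_dirac' _ hH, h0 _ (by simp)]

end Model

namespace Model

variable {K M : ℕ} (m : Model K M)

/-! ### Almost sure properties of the jump chain -/

/-- A node other than the cemetery is preceded by such a node with a smaller time, from which the
book has grown by at most one order per limit. -/
def Follows : Set (Node K M × Node K M) :=
  univ ×ˢ range Sum.inr ∪ Prod.map Sum.inl Sum.inl ''
    {q : (ℝ × State K M) × (ℝ × State K M) | q.1.1 ≤ q.2.1 ∧ m.Grows q.1.2.2 q.2.2.2}

lemma measurableSet_follows : MeasurableSet m.Follows := by
  refine (MeasurableSet.univ.prod measurableSet_range_inr).union ?_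
  have hinl : MeasurableEmbedding (Sum.inl : ℝ × State K M → Node K M) :=
    ⟨Sum.inl_injective, measurable_inl, fun _ hs => hs.inl_image⟩
  refine (hinl.prodMap hinl).measurableSet_image' ?_
  have hle : MeasurableSet {q : (ℝ × State K M) × (ℝ × State K M) | q.1.1 ≤ q.2.1} :=
    measurableSet_le (by fun_prop) (by fun_prop)
  refine hle.inter ?_
  have h : Measurable fun q : (ℝ × State K M) × (ℝ × State K M) => (q.1.2.2, q.2.2.2) := by
    fun_prop
  exact h (MeasurableSet.of_discrete (s := {c : Config K M × Config K M | m.Grows c.1 c.2}))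

lemma mem_follows_inl {x : Node K M} {q : ℝ × State K M} (h : (x, Sum.inl q) ∈ m.Follows) :
    ∃ p, x = Sum.inl p ∧ p.1 ≤ q.1 ∧ m.Grows p.2.2 q.2.2 := by
  rcases h with h | ⟨⟨p, q'⟩, h, h'⟩
  · simp at h
  · simp only [Prod.map_apply, Prod.mk.injEq, Sum.inl.injEq] at h'
    obtain ⟨h1, rfl⟩ := h'
    exact ⟨p, h1.symm, h.1, h.2⟩

lemma ae_nextJump_follows (p : ℝ × State K M) (a : Action K M) :
    ∀ᵐ y ∂(m.nextJump p a), (Sum.inl p, y) ∈ m.Follows := by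
  have hs : MeasurableSet {y | (Sum.inl p, y) ∈ m.Follows} :=
    measurable_prodMk_left m.measurableSet_follows
  by_cases h : m.totalRate p.2.2 = 0
  · rw [m.nextJump_of_totalRate_eq_zero a h, ae_dirac_iff hs]
    left
    simp
  · have hm : Measurable fun q : ℝ × State K M => (Sum.inl (p.1 + q.1, q.2) : Node K M) :=
      measurable_inl.comp (by fun_prop)
    rw [nextJump, if_neg h, ae_map_iff hm.aemeasurable hs]
    have := isProbabilityMeasure_expMeasure (r := m.totalRate p.2.2)
      (by exact_mod_cast pos_iff_ne_zero.2 h)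
    filter_upwards [Measure.quasiMeasurePreserving_fst.ae (ae_nonneg_expMeasure _),
      Measure.quasiMeasurePreserving_snd.ae (m.ae_jumpLaw_grows p.2 a)] with q h1 h2
    right
    refine ⟨(p, (p.1 + q.1, q.2)), ⟨?_, h2⟩, rfl⟩
    simpa using h1

lemma ae_law_follows (α : Policy K M) (t : ℝ) (z : State K M) :
    ∀ᵐ ω ∂(m.law α t z), ω 0 = Sum.inl (t, z) ∧ ∀ n, (ω n, ω (n + 1)) ∈ m.Follows := by
  refine (α.chainLaw_zero m.nextJump m.measurable_nextJump m.isProbabilityMeasure_nextJump t z).and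
    (α.ae_chainLaw_pair m.nextJump m.measurable_nextJump m.isProbabilityMeasure_nextJump t z
      (fun _ => m.measurableSet_follows) (fun n p => m.ae_nextJump_follows p _) fun n u => ?_)
  left
  simp

lemma volLE_of_follows {ω : ℕ → Node K M} {t : ℝ} {z : State K M} (h0 : ω 0 = Sum.inl (t, z))
    (h : ∀ n, (ω n, ω (n + 1)) ∈ m.Follows) {V : ℕ} (ha : m.askInf ≤ V) (hb : m.bidInf ≤ V)
    (hz : z.2.VolLE V) (n : ℕ) : ∀ p, ω n = Sum.inl p → p.2.2.VolLE (V + n) := by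
  induction n with
  | zero =>
    intro p hp
    rw [h0, Sum.inl.injEq] at hp
    subst hp
    exact hz
  | succ n ih =>
    intro q hq
    have hn := h n
    rw [hq] at hn
    obtain ⟨p, hp, -, hpq⟩ := m.mem_follows_inl hn
    exact hpq _ (ha.trans (Nat.le_add_right V n)) (hb.trans (Nat.le_add_right V n)) (ih p hp)

/-! ### Non-explosion -/

/-- `e^{-s T_n}`, zero at the cemetery. -/
def discount (s : ℝ) : Node K M → ℝ≥0∞ :=
  Sum.elim (fun p => ENNReal.ofReal (Real.exp (-(s * p.1)))) fun _ => 0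

lemma measurable_discount (s : ℝ) : Measurable (discount s : Node K M → ℝ≥0∞) :=
  Measurable.sumElim (by fun_prop) measurable_const

/-- The waiting time is independent of the past time and has Laplace transform `r / (r + s)`. At
rate zero the cemetery acts as an infinite jump time, and both sides vanish. -/
lemma lintegral_discount_nextJump {s : ℝ} (hs : 0 < s) (p : ℝ × State K M) (a : Action K M) :
    ∫⁻ y, discount s y ∂(m.nextJump p a) = discount s (Sum.inl p : Node K M)
      * ENNReal.ofReal (m.totalRate p.2.2 / (m.totalRate p.2.2 + s)) := by
  by_cases h : m.totalRate p.2.2 = 0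
  · rw [m.nextJump_of_totalRate_eq_zero a h, lintegral_dirac' _ (measurable_discount s)]
    simp [h, discount]
  · have hr : (0 : ℝ) < m.totalRate p.2.2 := by exact_mod_cast pos_iff_ne_zero.2 h
    have := m.isProbabilityMeasure_jumpLaw p.2 a h
    rw [m.lintegral_nextJump h (measurable_discount s), ← laplace_expMeasure hr hs.le,
      ← lintegral_const_mul _ (by fun_prop)]
    refine lintegral_congr fun u => ?_
    simp only [discount, Sum.elim_inl, lintegral_const, measure_univ, mul_one]
    rw [← ENNReal.ofReal_mul (by positivity), ← Real.exp_add]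
    congr 2
    ring

/-- Since `r / (r + L k)` increases with `r ≤ L (n + 1)`, step `n` costs a factor at most `(n + 1) /
(n + 1 + k)`. Taking `k` times `L` as discount rate cancels `L`, and the product is a ratio of
factorials of order `n^{-k}`. -/
lemma lintegral_discount_law_le (α : Policy K M) (t : ℝ) (z : State K M) {L : ℝ} (hL : 0 < L)
    (hrate : ∀ᵐ ω ∂(m.law α t z), ∀ (n : ℕ) p, ω n = Sum.inl p → (m.totalRate p.2.2 : ℝ) ≤ L * (n + 1))
    {k : ℕ} (hk : 0 < k) (n : ℕ) :
    ∫⁻ ω, discount (L * k) (ω n) ∂(m.law α t z) ≤ ENNReal.ofReal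
      (Real.exp (-(L * k * t)) * (k.factorial * (n.factorial / (n + k).factorial))) := by
  have := α.isProbabilityMeasure_chainLaw m.nextJump m.measurable_nextJump
    m.isProbabilityMeasure_nextJump t z
  have hs : 0 < L * k := by positivity
  induction n with
  | zero =>
    have h0 := α.chainLaw_zero m.nextJump m.measurable_nextJump m.isProbabilityMeasure_nextJump t z
    unfold law
    rw [lintegral_congr_ae (h0.mono fun ω h => congrArg (discount (L * k)) h)]
    have : (k.factorial : ℝ) ≠ 0 := by positivity
    simp [discount, this]
  | succ n ih =>
    have e := α.lintegral_chainLaw_succ m.nextJump m.measurable_nextJump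
      m.isProbabilityMeasure_nextJump t z n (measurable_discount (L * k))
    have hle : ∀ᵐ ω ∂(m.law α t z), ∫⁻ y, discount (L * k) y
        ∂(α.step m.nextJump m.measurable_nextJump n (ω n))
        ≤ discount (L * k) (ω n) * ENNReal.ofReal ((n + 1) / (n + 1 + k)) := by
      filter_upwards [hrate] with ω hω
      rcases hx : ω n with p | u
      · refine (m.lintegral_discount_nextJump hs p _).trans_le ?_
        refine mul_le_mul_right (ENNReal.ofReal_le_ofReal ?_) _
        have hp := hω n p hx
        have hr : (0 : ℝ) ≤ m.totalRate p.2.2 := NNReal.coe_nonneg _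
        rw [div_le_div_iff₀ (by positivity) (by positivity)]
        have hkr : (0 : ℝ) < k := by exact_mod_cast hk
        nlinarith
      · change ∫⁻ y, discount (L * k) y ∂(Measure.dirac (Sum.inr u)) ≤ _
        rw [lintegral_dirac' _ (measurable_discount _)]
        simp [discount]
    change ∫⁻ ω, discount (L * k) (ω (n + 1)) ∂(α.chainLaw _ _ _ t z) ≤ _
    rw [e]
    refine (lintegral_mono_ae hle).trans ?_
    have hdm : Measurable fun ω : ℕ → Node K M => discount (L * k) (ω n) :=
      (measurable_discount _).comp (measurable_pi_apply n)
    rw [lintegral_mul_const _ hdm]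
    refine (mul_le_mul_left ih _).trans ?_
    rw [← ENNReal.ofReal_mul (by positivity)]
    refine ENNReal.ofReal_le_ofReal (le_of_eq ?_)
    have h1 : ((n + 1).factorial : ℝ) = (n + 1) * n.factorial := by
      rw [Nat.factorial_succ]; push_cast; ring
    have h2 : ((n + 1 + k).factorial : ℝ) = (n + 1 + k) * (n + k).factorial := by
      rw [show n + 1 + k = (n + k) + 1 by ring, Nat.factorial_succ]; push_cast; ring
    rw [h1, h2]
    have : ((n + k).factorial : ℝ) ≠ 0 := by positivity
    have : (n : ℝ) + 1 + k ≠ 0 := by positivity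
    field_simp

/-- The number of arrivals before the horizon has tails of every polynomial order. -/
lemma exists_law_alive_le (h : m.LinearIntensities) (α : Policy K M) (t : ℝ) (z : State K M)
    {k : ℕ} (hk : 0 < k) : ∃ C : ℝ, 0 ≤ C ∧ ∀ n : ℕ,
      m.law α t z {ω | ω n ∈ alive m.T} ≤ ENNReal.ofReal (C / (n + 1 : ℝ) ^ k) := by
  -- One bound for the initial book and for both boundary volumes.
  obtain ⟨V, ha, hb, hz⟩ : ∃ V, m.askInf ≤ V ∧ m.bidInf ≤ V ∧ z.2.VolLE V := by
    refine ⟨m.askInf + m.bidInf + ∑ i, z.2.ask.vol i + ∑ i, z.2.bid.vol i, by omega, by omega,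
      fun i => ⟨?_, ?_⟩⟩
    · have := Finset.single_le_sum (f := z.2.ask.vol) (fun j _ => Nat.zero_le _) (Finset.mem_univ i)
      omega
    · have := Finset.single_le_sum (f := z.2.bid.vol) (fun j _ => Nat.zero_le _) (Finset.mem_univ i)
      omega
  obtain ⟨L, hL, hLr⟩ := m.exists_totalRate_le h V
  have hrate : ∀ᵐ ω ∂(m.law α t z), ∀ (n : ℕ) p, ω n = Sum.inl p →
      (m.totalRate p.2.2 : ℝ) ≤ L * (n + 1) := by
    filter_upwards [m.ae_law_follows α t z] with ω hω n p hp
    exact hLr n _ (m.volLE_of_follows hω.1 hω.2 ha hb hz n p hp)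
  refine ⟨Real.exp (L * k * m.T) * (Real.exp (-(L * k * t)) * k.factorial), by positivity,
    fun n => ?_⟩
  have hmeas : MeasurableSet {ω : ℕ → Node K M | ω n ∈ alive m.T} :=
    measurable_pi_apply n (measurableSet_alive m.T)
  rw [← lintegral_indicator_one hmeas]
  -- Chernoff bound: on `T_n ≤ T` one has `1 ≤ e^{L k T} e^{-L k T_n}`.
  have hle : ∀ ω : ℕ → Node K M, {ω : ℕ → Node K M | ω n ∈ alive m.T}.indicator 1 ω
      ≤ ENNReal.ofReal (Real.exp (L * k * m.T)) * discount (L * k) (ω n) := by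
    intro ω
    by_cases hω : ω n ∈ alive m.T
    swap
    · rw [indicator_of_notMem (by exact hω)]
      exact zero_le
    rw [indicator_of_mem (by exact hω)]
    obtain ⟨p, hp, hpω⟩ := hω
    rw [← hpω, Pi.one_apply, discount, Sum.elim_inl, ← ENNReal.ofReal_mul (by positivity),
      ← Real.exp_add, ENNReal.one_le_ofReal, Real.one_le_exp_iff]
    have : L * k * p.1 ≤ L * k * m.T := mul_le_mul_of_nonneg_left hp (by positivity)
    linarith
  refine (lintegral_mono hle).trans ?_
  have hdm : Measurable fun ω : ℕ → Node K M => discount (L * k) (ω n) :=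
    (measurable_discount _).comp (measurable_pi_apply n)
  rw [lintegral_const_mul _ hdm]
  refine (mul_le_mul_right (m.lintegral_discount_law_le α t z hL hrate hk n) _).trans ?_
  rw [← ENNReal.ofReal_mul (by positivity)]
  refine ENNReal.ofReal_le_ofReal ?_
  have hfac : (n.factorial : ℝ) / (n + k).factorial ≤ 1 / (n + 1 : ℝ) ^ k := by
    rw [div_le_div_iff₀ (by positivity) (by positivity), one_mul]
    exact_mod_cast Nat.factorial_mul_pow_le_factorial
  have := mul_le_mul_of_nonneg_left hfac
    (by positivity : 0 ≤ Real.exp (L * k * m.T) * (Real.exp (-(L * k * t)) * k.factorial))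
  calc _ = Real.exp (L * k * m.T) * (Real.exp (-(L * k * t)) * k.factorial)
        * (n.factorial / (n + k).factorial) := by ring
    _ ≤ _ := this
    _ = _ := by ring

/-- The number of arrivals before the horizon has moments of all orders. -/
lemma tsum_pow_mul_law_alive_ne_top (h : m.LinearIntensities) (α : Policy K M) (t : ℝ)
    (z : State K M) (c : ℝ) (d : ℕ) :
    ∑' n : ℕ, ENNReal.ofReal (c * (1 + n : ℝ) ^ d) * m.law α t z {ω | ω n ∈ alive m.T} ≠ ∞ := by
  -- Tails of order `d + 2` absorb the weight `(1 + n)^d` and leave the summable `1 / (n + 1)^2`.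
  obtain ⟨C, hC, hle⟩ := m.exists_law_alive_le h α t z (k := d + 2) (by omega)
  have hs : Summable fun n : ℕ => |c| * C * (1 / ((n : ℝ) + 1) ^ 2) := by
    have := (summable_nat_add_iff 1).2 (Real.summable_one_div_nat_pow.2 (one_lt_two : 1 < 2))
    refine Summable.mul_left _ ?_
    exact_mod_cast this
  refine ne_top_of_le_ne_top hs.tsum_ofReal_ne_top (ENNReal.tsum_le_tsum fun n => ?_)
  have h1 : ENNReal.ofReal (c * (1 + n : ℝ) ^ d) ≤ ENNReal.ofReal (|c| * (1 + n : ℝ) ^ d) :=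
    ENNReal.ofReal_le_ofReal (mul_le_mul_of_nonneg_right (le_abs_self c) (by positivity))
  refine (mul_le_mul' h1 (hle n)).trans ?_
  rw [← ENNReal.ofReal_mul (by positivity)]
  refine ENNReal.ofReal_le_ofReal (le_of_eq ?_)
  rw [pow_add, add_comm (1 : ℝ)]
  field_simp

lemma tsum_law_alive_ne_top (h : m.LinearIntensities) (α : Policy K M) (t : ℝ) (z : State K M) :
    ∑' n : ℕ, m.law α t z {ω | ω n ∈ alive m.T} ≠ ∞ := by
  simpa using m.tsum_pow_mul_law_alive_ne_top h α t z 1 0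

/-- Non-explosion, by the Borel–Cantelli lemma. -/
lemma ae_law_finite_alive (h : m.LinearIntensities) (α : Policy K M) (t : ℝ) (z : State K M) :
    ∀ᵐ ω ∂(m.law α t z), {n | ω n ∈ alive m.T}.Finite :=
  ae_finite_setOfPred_mem (m.tsum_law_alive_ne_top h α t z)

/-- Borel–Cantelli involves only the marginals, and up to the horizon these are shared by the two
chains. -/
lemma ae_mdpChain_finite_alive (h : m.LinearIntensities) (α : Policy K M) (t : ℝ)
    (z : State K M) : ∀ᵐ ω ∂(m.mdpChain α t z), {n | ω n ∈ alive m.T}.Finite := by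
  suffices hs : ∑' n : ℕ, m.mdpChain α t z {ω | ω n ∈ alive m.T} ≠ ∞ from
    ae_finite_setOfPred_mem hs
  refine ne_of_eq_of_ne (tsum_congr fun n => ?_) (m.tsum_law_alive_ne_top h α t z)
  have e := m.lintegral_law_eq_mdpChain α t z n (H := (alive m.T).indicator 1)
    (measurable_one.indicator (measurableSet_alive _)) fun x hx => indicator_of_notMem hx _
  have hmeas : MeasurableSet {ω : ℕ → Node K M | ω n ∈ alive m.T} :=
    measurable_pi_apply n (measurableSet_alive m.T)
  rw [← lintegral_indicator_one hmeas, ← lintegral_indicator_one hmeas]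
  exact e.symm

end Model

/-! ### Trajectories with finitely many jumps -/

/-- A trajectory of the jump chain that starts at time `t`, with ordered jump times of which finitely
many are at most `T`. -/
structure Regular {K M : ℕ} (ω : ℕ → Node K M) (t T : ℝ) : Prop where
  zero : ∃ z, ω 0 = Sum.inl (t, z)
  mono : ∀ n q, ω (n + 1) = Sum.inl q → ∃ p, ω n = Sum.inl p ∧ p.1 ≤ q.1
  finite : {n | ω n ∈ alive T}.Finite

namespace Regular

variable {K M : ℕ} {ω : ℕ → Node K M} {t T : ℝ}

lemma alive_of_le (h : Regular ω t T) {s : ℝ} {k n : ℕ} (hkn : k ≤ n) (hn : ω n ∈ alive s) : ω k ∈ alive s := by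
  induction hkn with
  | refl => exact hn
  | step _ ih =>
    obtain ⟨q, hq, hqn⟩ := hn
    obtain ⟨p, hp, hpq⟩ := h.mono _ q hqn.symm
    exact ih ⟨p, hpq.trans hq, hp.symm⟩

lemma le_time (h : Regular ω t T) {n : ℕ} {p : ℝ × State K M} (hp : ω n = Sum.inl p) : t ≤ p.1 := by
  obtain ⟨z, hz⟩ := h.zero
  have := h.alive_of_le (Nat.zero_le n) (s := p.1) (by rw [hp]; simp)
  simpa [hz] using this

/-- Ordered jump times make the indices with `T_n ≤ s` an initial segment, determined by its last
element. That segment is nonempty because `t ≤ s`, and finite; on an unbounded set `sSup` would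
return `0`. -/
lemma arrivals_eq_iff (h : Regular ω t T) {s : ℝ} (hts : t ≤ s) (hsT : s ≤ T) (n : ℕ) :
    arrivals ω s = n ↔ ω n ∈ alive s ∧ ω (n + 1) ∉ alive s := by
  have hset : {n | ∃ p, ω n = Sum.inl p ∧ p.1 ≤ s} = {n | ω n ∈ alive s} := by
    ext n
    constructor
    · rintro ⟨p, hp, hps⟩
      exact ⟨p, hps, hp.symm⟩
    · rintro ⟨p, hps, hp⟩
      exact ⟨p, hp.symm, hps⟩
  have hfin : {n | ω n ∈ alive s}.Finite := h.finite.subset (by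
    rintro n ⟨p, hps, hp⟩
    exact ⟨p, le_trans hps hsT, hp⟩)
  have hne : {n | ω n ∈ alive s}.Nonempty := by
    obtain ⟨z, hz⟩ := h.zero
    exact ⟨0, by simpa [hz] using hts⟩
  have hmem : ω (arrivals ω s) ∈ alive s := by
    rw [arrivals, hset]
    exact Nat.sSup_mem hne hfin.bddAbove
  have hmax : ∀ k, ω k ∈ alive s → k ≤ arrivals ω s := by
    intro k hk
    rw [arrivals, hset]
    exact le_csSup hfin.bddAbove hk
  constructor
  · rintro rfl
    exact ⟨hmem, fun hn => absurd (hmax _ hn) (by omega)⟩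
  · rintro ⟨h1, h2⟩
    refine le_antisymm ?_ (hmax n h1)
    by_contra hlt
    exact h2 (h.alive_of_le (by omega) hmem)

/-- The times at which the `n`-th period is the current one. -/
def period (ω : ℕ → Node K M) (n : ℕ) : Set ℝ := {s | ω n ∈ alive s ∧ ω (n + 1) ∉ alive s}

/-- Duration of the `n`-th period up to the horizon. -/
lemma volume_period (h : Regular ω t T) {n : ℕ} {p : ℝ × State K M} (hp : ω n = Sum.inl p) :
    MeasurableSet (period ω n ∩ Icc t T) ∧
    volume (period ω n ∩ Icc t T) = ENNReal.ofReal (endTime T (ω (n + 1)) - p.1) := by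
  have hpt := h.le_time hp
  -- The case of a period still running at the horizon. If it starts after `T`, the interval is
  -- empty and `ENNReal.ofReal` truncates the negative length to `0`.
  have hIcc : (∀ s, s ≤ T → ω (n + 1) ∉ alive s) → period ω n ∩ Icc t T = Icc p.1 T := by
    intro hs
    ext s
    simp only [period, hp, inl_mem_alive, mem_inter_iff, mem_ofPred_eq, mem_Icc]
    exact ⟨fun ⟨⟨h1, _⟩, _, h4⟩ => ⟨h1, h4⟩, fun ⟨h1, h2⟩ => ⟨⟨h1, hs s h2⟩, hpt.trans h1, h2⟩⟩
  rcases hq : ω (n + 1) with q | u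
  · rcases le_or_gt q.1 T with hqT | hqT
    · have : period ω n ∩ Icc t T = Ico p.1 q.1 := by
        ext s
        simp only [period, hp, hq, inl_mem_alive, mem_inter_iff, mem_ofPred_eq, mem_Icc, mem_Ico,
          not_le]
        exact ⟨fun h1 => h1.1, fun h1 => ⟨h1, hpt.trans h1.1, h1.2.le.trans hqT⟩⟩
      rw [this]
      refine ⟨measurableSet_Ico, ?_⟩
      simp [endTime, min_eq_left hqT]
    · rw [hIcc fun s hs => by rw [hq]; simp; linarith]
      refine ⟨measurableSet_Icc, ?_⟩
      simp [endTime, min_eq_right hqT.le]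
  · rw [hIcc fun s hs => by rw [hq]; simp]
    refine ⟨measurableSet_Icc, ?_⟩
    simp [endTime]

/-- Integral over `[t, T]` of a function of the index of the current period. -/
lemma integral_arrivals (h : Regular ω t T) (hT : t ≤ T) (c : ℕ → ℝ) :
    IntegrableOn (fun s => c (arrivals ω s)) (Icc t T) ∧
    HasSum (fun n => Sum.elim (fun p : ℝ × State K M =>
      if p.1 ≤ T then c n * max (endTime T (ω (n + 1)) - p.1) 0 else 0) (fun _ => 0) (ω n))
      (∫ s in t..T, c (arrivals ω s)) := by
  classical
  set F := h.finite.toFinset with hF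
  have hmemF : ∀ n, n ∈ F ↔ ω n ∈ alive T := fun n => by simp [hF]
  -- On `[t, T]` the integrand is a step function: exactly one period contains each time, and
  -- finitely many periods matter.
  have hG : (Icc t T).indicator (fun s => c (arrivals ω s))
      = fun s => ∑ n ∈ F, (period ω n ∩ Icc t T).indicator (fun _ => c n) s := by
    funext s
    by_cases hs : s ∈ Icc t T
    · have harr := (h.arrivals_eq_iff hs.1 hs.2 (arrivals ω s)).1 rfl
      rw [indicator_of_mem hs, Finset.sum_eq_single (arrivals ω s)]
      · rw [indicator_of_mem (show s ∈ period ω (arrivals ω s) ∩ Icc t T from ⟨harr, hs⟩)]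
      · intro n _ hn
        refine indicator_of_notMem (fun hn' => hn ?_) _
        exact ((h.arrivals_eq_iff hs.1 hs.2 n).2 hn'.1).symm
      · intro hn
        refine absurd ?_ hn
        rw [hmemF]
        obtain ⟨p, hps, hp⟩ := harr.1
        exact ⟨p, le_trans hps hs.2, hp⟩
    · rw [indicator_of_notMem hs]
      exact (Finset.sum_eq_zero fun n _ => indicator_of_notMem (fun hn => hs hn.2) _).symm
  have hper : ∀ n ∈ F, ∃ p, ω n = Sum.inl p ∧ p.1 ≤ T := by
    intro n hn
    obtain ⟨p, hpT, hp⟩ := (hmemF n).1 hn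
    exact ⟨p, hp.symm, hpT⟩
  have hint : ∀ n ∈ F, Integrable ((period ω n ∩ Icc t T).indicator fun _ => c n) := by
    intro n hn
    obtain ⟨p, hp, -⟩ := hper n hn
    obtain ⟨h1, h2⟩ := h.volume_period hp
    rw [integrable_indicator_iff h1]
    exact integrableOn_const (by rw [h2]; exact ENNReal.ofReal_ne_top)
  refine ⟨?_, ?_⟩
  · rw [← integrable_indicator_iff measurableSet_Icc, hG]
    exact integrable_finsetSum _ hint
  · have hval : ∫ s in t..T, c (arrivals ω s) = ∑ n ∈ F, Sum.elim (fun p : ℝ × State K M =>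
        if p.1 ≤ T then c n * max (endTime T (ω (n + 1)) - p.1) 0 else 0) (fun _ => 0) (ω n) := by
      rw [intervalIntegral.integral_of_le hT, ← integral_Icc_eq_integral_Ioc,
        ← integral_indicator measurableSet_Icc, hG, integral_finsetSum _ hint]
      refine Finset.sum_congr rfl fun n hn => ?_
      obtain ⟨p, hp, hpT⟩ := hper n hn
      obtain ⟨h1, h2⟩ := h.volume_period hp
      rw [integral_indicator_const _ h1, measureReal_def, h2, ENNReal.toReal_ofReal', hp,
        Sum.elim_inl, if_pos hpT, smul_eq_mul, mul_comm]
    rw [hval]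
    refine hasSum_sum_of_ne_finset_zero fun n hn => ?_
    rw [hmemF] at hn
    rcases hx : ω n with p | u
    · rw [hx, inl_mem_alive] at hn
      rw [Sum.elim_inl, if_neg hn]
    · rfl

/-- A function of the index of the last period. -/
lemma hasSum_arrivals (h : Regular ω t T) (hT : t ≤ T) (c : ℕ → ℝ)
    [∀ x : Node K M, Decidable (x ∈ alive T)] :
    HasSum (fun n => Sum.elim (fun p : ℝ × State K M =>
      if p.1 ≤ T then (if ω (n + 1) ∈ alive T then 0 else c n) else 0) (fun _ => 0) (ω n))
      (c (arrivals ω T)) := by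
  have harr := (h.arrivals_eq_iff hT le_rfl (arrivals ω T)).1 rfl
  obtain ⟨⟨p, hpT, hp⟩, hnot⟩ := harr
  convert hasSum_single (arrivals ω T) ?_ using 1
  · rw [← hp, Sum.elim_inl, if_pos (show p.1 ≤ T from hpT), if_neg hnot]
  · intro n hn
    rcases hx : ω n with q | u
    · rw [Sum.elim_inl]
      split_ifs with h1 h2
      · rfl
      · refine absurd ((h.arrivals_eq_iff hT le_rfl n).2 ⟨?_, h2⟩).symm hn
        rw [hx]
        simpa using h1
      · rfl
    · rfl

end Regular

namespace Model

variable {K M : ℕ} (m : Model K M)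

/-! ### Rewards per period -/

open Classical in
/-- The reward of the continuous-time problem collected in the period between the `n`-th node `x` and
the next node `y`, the terminal reward being collected in the last period before the horizon. -/
def periodReward (α : Policy K M) (n : ℕ) (x y : Node K M) : ℝ :=
  Sum.elim (fun p => if p.1 ≤ m.T then
      -- The `max` makes the duration nonnegative even for nodes out of order, so nonnegative
      -- rewards give nonnegative period rewards everywhere and not just almost surely.
      m.f (α.rule n p) (afterDecision (α.rule n p) p.2) * max (endTime m.T y - p.1) 0
        + (if y ∈ alive m.T then 0 else m.g (afterDecision (α.rule n p) p.2))
    else 0) (fun _ => 0) x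

lemma measurable_runningReward (hf : ∀ a, Measurable (m.f a)) (α : Policy K M) (n : ℕ) :
    Measurable fun p => m.f (α.rule n p) (afterDecision (α.rule n p) p.2) :=
  α.measurable_comp_rule n (F := fun a p => m.f a (afterDecision a p.2)) fun a =>
    (hf a).comp ((measurable_afterDecision a).comp measurable_snd)

lemma measurable_terminalReward (hg : Measurable m.g) (α : Policy K M) (n : ℕ) :
    Measurable fun p => m.g (afterDecision (α.rule n p) p.2) :=
  α.measurable_comp_rule n (F := fun a p => m.g (afterDecision a p.2)) fun a =>
    hg.comp ((measurable_afterDecision a).comp measurable_snd)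

lemma measurable_periodReward (hf : ∀ a, Measurable (m.f a)) (hg : Measurable m.g)
    (α : Policy K M) (n : ℕ) :
    Measurable fun q : Node K M × Node K M => m.periodReward α n q.1 q.2 := by
  classical
  refine measurable_sum_prod ?_ measurable_const
  refine Measurable.ite (measurableSet_le (by fun_prop) measurable_const) ?_ measurable_const
  refine Measurable.add (Measurable.mul ((m.measurable_runningReward hf α n).comp measurable_fst) ?_)
    (Measurable.ite (measurable_snd (measurableSet_alive _)) measurable_const
      ((m.measurable_terminalReward hg α n).comp measurable_fst))
  exact (((measurable_endTime _).comp measurable_snd).sub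
    (measurable_fst.comp measurable_fst)).max measurable_const

lemma measurable_reward (hf : ∀ a, Measurable (m.f a)) (hg : Measurable m.g) (a : Action K M) :
    Measurable fun p : ℝ × State K M => m.reward p.1 p.2 a := by
  classical
  have hl : Measurable fun p : ℝ × State K M => (m.totalRate p.2.2 : ℝ) :=
    (Measurable.of_discrete (f := fun c : Config K M => (m.totalRate c : ℝ))).comp
      (measurable_snd.comp measurable_snd)
  have he : Measurable fun p : ℝ × State K M =>
      Real.exp (-((m.totalRate p.2.2 : ℝ) * (m.T - p.1))) := by fun_prop
  have ha : Measurable fun p : ℝ × State K M => afterDecision a p.2 :=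
    (measurable_afterDecision a).comp measurable_snd
  unfold reward
  refine Measurable.ite (measurableSet_le (by fun_prop) measurable_const) ?_ measurable_const
  refine (((hf a).comp ha).mul ?_).add (he.mul (hg.comp ha))
  exact Measurable.ite (hl (measurableSet_singleton 0)) (by fun_prop)
    ((measurable_const.div hl).sub (he.div hl))

lemma measurable_stepReward (hf : ∀ a, Measurable (m.f a)) (hg : Measurable m.g)
    (α : Policy K M) (n : ℕ) : Measurable fun ω : ℕ → Node K M => m.stepReward α ω n := by
  have h : Measurable (Sum.elim (fun p => m.reward p.1 p.2 (α.rule n p)) (fun _ => 0) :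
      Node K M → ℝ) :=
    Measurable.sumElim (α.measurable_comp_rule n (F := fun a p => m.reward p.1 p.2 a)
      (m.measurable_reward hf hg)) measurable_const
  exact h.comp (measurable_pi_apply n)

/-- The reward of one step of the decision process is the mean of the reward of one period. -/
lemma lintegral_periodReward (hf : ∀ a, Measurable (m.f a)) (hg : Measurable m.g)
    (hf0 : ∀ a z, 0 ≤ m.f a z) (hg0 : ∀ z, 0 ≤ m.g z) (α : Policy K M) (n : ℕ)
    (p : ℝ × State K M) :
    ∫⁻ y, ENNReal.ofReal (m.periodReward α n (Sum.inl p) y) ∂(m.nextJump p (α.rule n p))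
      = ENNReal.ofReal (m.reward p.1 p.2 (α.rule n p)) := by
  classical
  have hm : Measurable fun y => ENNReal.ofReal (m.periodReward α n (Sum.inl p) y) :=
    ((m.measurable_periodReward hf hg α n).comp measurable_prodMk_left).ennreal_ofReal
  by_cases hpT : p.1 ≤ m.T
  swap
  · simp [periodReward, reward, hpT]
  by_cases h : m.totalRate p.2.2 = 0
  · rw [m.nextJump_of_totalRate_eq_zero _ h, lintegral_dirac' _ hm]
    simp [periodReward, reward, hpT, h, endTime]
  · have hr : (0 : ℝ) < m.totalRate p.2.2 := by exact_mod_cast pos_iff_ne_zero.2 h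
    have := m.isProbabilityMeasure_jumpLaw p.2 (α.rule n p) h
    rw [m.lintegral_nextJump h hm]
    have e := lintegral_expMeasure_reward hr (sub_nonneg.2 hpT)
      (hf0 (α.rule n p) (afterDecision (α.rule n p) p.2)) (hg0 (afterDecision (α.rule n p) p.2))
    simp only [reward, if_pos hpT, if_neg hr.ne']
    rw [← e]
    -- The period reward depends on the next node only through its time, so the integral over the
    -- new state contributes a factor `1`.
    refine lintegral_congr_ae ?_
    filter_upwards [ae_nonneg_expMeasure _] with s hs
    have h1 : min (p.1 + s) m.T - p.1 = min s (m.T - p.1) := by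
      rw [← min_sub_sub_right, add_sub_cancel_left]
    have h2 : p.1 + s ≤ m.T ↔ s ≤ m.T - p.1 := by constructor <;> intro _ <;> linarith
    simp only [periodReward, Sum.elim_inl, if_pos hpT, endTime, inl_mem_alive, h1, h2,
      max_eq_left (le_min hs (sub_nonneg.2 hpT)), lintegral_const, measure_univ, mul_one]

/-- For nonnegative rewards the mean rewards of the `n`-th period and of the `n`-th step coincide. -/
lemma lintegral_periodReward_law (hf : ∀ a, Measurable (m.f a)) (hg : Measurable m.g)
    (hf0 : ∀ a z, 0 ≤ m.f a z) (hg0 : ∀ z, 0 ≤ m.g z) (α : Policy K M) (t : ℝ) (z : State K M)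
    (n : ℕ) :
    ∫⁻ ω, ENNReal.ofReal (m.periodReward α n (ω n) (ω (n + 1))) ∂(m.law α t z)
      = ∫⁻ ω, ENNReal.ofReal (m.stepReward α ω n) ∂(m.mdpChain α t z) := by
  have e := α.lintegral_chainLaw_pair m.nextJump m.measurable_nextJump
    m.isProbabilityMeasure_nextJump t z n (m.measurable_periodReward hf hg α n).ennreal_ofReal
  have hR : Measurable (Sum.elim (fun p => m.reward p.1 p.2 (α.rule n p)) (fun _ => 0) :
      Node K M → ℝ) :=
    Measurable.sumElim (α.measurable_comp_rule n (F := fun a p => m.reward p.1 p.2 a)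
      (m.measurable_reward hf hg)) measurable_const
  -- Once the next node is integrated out, only a function of the `n`-th node that vanishes beyond
  -- the horizon remains, to which the comparison of marginals applies.
  refine e.trans (Eq.trans (lintegral_congr fun ω => ?_)
    (m.lintegral_law_eq_mdpChain α t z n hR.ennreal_ofReal ?_))
  · rcases ω n with p | u
    · exact m.lintegral_periodReward hf hg hf0 hg0 α n p
    · simp [periodReward]
  · rintro (p | u) hx
    · rw [inl_mem_alive] at hx
      simp [reward, hx]
    · simp

/-! ### Positive and negative parts -/

/-- The same order book with other rewards. -/
def withRewards (F : Action K M → State K M → ℝ) (G : State K M → ℝ) : Model K M :=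
  { m with f := F, g := G }

/-- The positive parts of the rewards. -/
def positivePart : Model K M := m.withRewards (fun a z => max (m.f a z) 0) fun z => max (m.g z) 0

/-- The negative parts of the rewards. -/
def negativePart : Model K M :=
  m.withRewards (fun a z => max (-m.f a z) 0) fun z => max (-m.g z) 0

lemma max_sub_max_neg (x : ℝ) : max x 0 - max (-x) 0 = x := by
  rcases le_total 0 x with h | h
  · rw [max_eq_left h, max_eq_right (by linarith), sub_zero]
  · rw [max_eq_right h, max_eq_left (by linarith), zero_sub, neg_neg]

lemma ofReal_max_zero (x : ℝ) : ENNReal.ofReal (max x 0) = ENNReal.ofReal x := by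
  rcases le_total 0 x with h | h
  · rw [max_eq_left h]
  · rw [max_eq_right h, ENNReal.ofReal_zero, ENNReal.ofReal_of_nonpos h]

/-- The period reward is linear in the pair `(f, g)`. The parts taken are those of `f` and `g`, so
the two terms on the right can both be positive. -/
lemma periodReward_eq_sub (α : Policy K M) (n : ℕ) (x y : Node K M) :
    m.periodReward α n x y
      = m.positivePart.periodReward α n x y - m.negativePart.periodReward α n x y := by
  classical
  have key : ∀ F G p, (m.withRewards F G).periodReward α n (Sum.inl p) y
      = if p.1 ≤ m.T then F (α.rule n p) (afterDecision (α.rule n p) p.2)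
            * max (endTime m.T y - p.1) 0
          + (if y ∈ alive m.T then 0 else G (afterDecision (α.rule n p) p.2)) else 0 :=
    fun F G p => rfl
  rcases x with p | u
  · refine (key m.f m.g p).trans ?_
    change _ = (m.withRewards _ _).periodReward α n _ y - (m.withRewards _ _).periodReward α n _ y
    rw [key, key]
    split_ifs
    · rw [add_zero, add_zero, add_zero, ← sub_mul, max_sub_max_neg]
    · rw [add_sub_add_comm, ← sub_mul, max_sub_max_neg, max_sub_max_neg]
    · simp
  · simp [periodReward]

lemma reward_eq_sub (t : ℝ) (z : State K M) (a : Action K M) :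
    m.reward t z a = m.positivePart.reward t z a - m.negativePart.reward t z a := by
  classical
  have key : ∀ F G, (m.withRewards F G).reward t z a
      = if t ≤ m.T then F a (afterDecision a z) * (if (m.totalRate z.2 : ℝ) = 0 then m.T - t
          else 1 / (m.totalRate z.2 : ℝ)
            - Real.exp (-((m.totalRate z.2 : ℝ) * (m.T - t))) / (m.totalRate z.2 : ℝ))
        + Real.exp (-((m.totalRate z.2 : ℝ) * (m.T - t))) * G (afterDecision a z) else 0 :=
    fun F G => rfl
  refine (key m.f m.g).trans ?_
  change _ = (m.withRewards _ _).reward t z a - (m.withRewards _ _).reward t z a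
  rw [key, key]
  by_cases h : t ≤ m.T
  · rw [if_pos h, if_pos h, if_pos h, add_sub_add_comm, ← sub_mul, ← mul_sub, max_sub_max_neg,
      max_sub_max_neg]
  · simp [h]

lemma stepReward_eq_sub (α : Policy K M) (ω : ℕ → Node K M) (n : ℕ) :
    m.stepReward α ω n = m.positivePart.stepReward α ω n - m.negativePart.stepReward α ω n := by
  unfold stepReward
  rcases ω n with p | u
  · exact m.reward_eq_sub _ _ _
  · simp

lemma periodReward_nonneg (hf0 : ∀ a z, 0 ≤ m.f a z) (hg0 : ∀ z, 0 ≤ m.g z) (α : Policy K M)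
    (n : ℕ) (x y : Node K M) : 0 ≤ m.periodReward α n x y := by
  classical
  rcases x with p | u
  · simp only [periodReward, Sum.elim_inl]
    split_ifs
    · have := mul_nonneg (hf0 (α.rule n p) (afterDecision (α.rule n p) p.2))
        (le_max_right (endTime m.T y - p.1) 0)
      linarith
    · exact add_nonneg (mul_nonneg (hf0 _ _) (le_max_right _ _)) (hg0 _)
    · exact le_rfl
  · exact le_rfl

lemma stepReward_nonneg (hf0 : ∀ a z, 0 ≤ m.f a z) (hg0 : ∀ z, 0 ≤ m.g z) (α : Policy K M)
    (ω : ℕ → Node K M) (n : ℕ) : 0 ≤ m.stepReward α ω n := by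
  classical
  unfold stepReward
  rcases ω n with p | u
  · simp only [Sum.elim_inl, reward]
    split_ifs with h1 h2
    · have := sub_nonneg.2 h1
      have := hf0 (α.rule n p) (afterDecision (α.rule n p) p.2)
      have := hg0 (afterDecision (α.rule n p) p.2)
      positivity
    · refine add_nonneg (mul_nonneg (hf0 _ _) ?_) (mul_nonneg (Real.exp_pos _).le (hg0 _))
      rw [← sub_div]
      refine div_nonneg (sub_nonneg.2 (Real.exp_le_one_iff.2 ?_)) (NNReal.coe_nonneg _)
      have := mul_nonneg (m.totalRate p.2.2).coe_nonneg (sub_nonneg.2 h1)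
      linarith
    · exact le_rfl
  · exact le_rfl

lemma periodReward_of_notMem (α : Policy K M) (n : ℕ) {x : Node K M} (hx : x ∉ alive m.T)
    (y : Node K M) : m.periodReward α n x y = 0 := by
  rcases x with p | u
  · rw [inl_mem_alive] at hx
    simp [periodReward, hx]
  · rfl

lemma stepReward_of_notMem (α : Policy K M) {ω : ℕ → Node K M} {n : ℕ} (hx : ω n ∉ alive m.T) :
    m.stepReward α ω n = 0 := by
  unfold stepReward
  rcases h : ω n with p | u
  · rw [h, inl_mem_alive] at hx
    simp [reward, hx]
  · rfl

/-! ### Rewards along a trajectory -/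

/-- The reward of a trajectory is the sum of the rewards of its periods. -/
lemma hasSum_periodReward {α : Policy K M} {ω : ℕ → Node K M} {t : ℝ} (h : Regular ω t m.T)
    (hT : t ≤ m.T) :
    IntegrableOn (fun s => m.f (current α ω s).1 (current α ω s).2) (Icc t m.T) ∧
    HasSum (fun n => m.periodReward α n (ω n) (ω (n + 1)))
      ((∫ s in t..m.T, m.f (current α ω s).1 (current α ω s).2) + m.g (current α ω m.T).2) := by
  classical
  -- On a fixed trajectory the running reward depends on time only through the index of the period.
  -- The value at the cemetery matches the default of `current`, so `hc` holds at all times.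
  let c : ℕ → ℝ := fun n => Sum.elim
    (fun p => m.f (α.rule n p) (afterDecision (α.rule n p) p.2))
    (fun _ => m.f default default) (ω n)
  let c' : ℕ → ℝ := fun n => Sum.elim
    (fun p => m.g (afterDecision (α.rule n p) p.2)) (fun _ => m.g default) (ω n)
  have hc : ∀ s, m.f (current α ω s).1 (current α ω s).2 = c (arrivals ω s) := by
    intro s
    simp only [current, c]
    rcases ω (arrivals ω s) with p | u <;> rfl
  have hc' : m.g (current α ω m.T).2 = c' (arrivals ω m.T) := by
    simp only [current, c']
    rcases ω (arrivals ω m.T) with p | u <;> rfl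
  simp_rw [hc, hc']
  obtain ⟨h1, h2⟩ := h.integral_arrivals hT c
  refine ⟨h1, ?_⟩
  convert h2.add (h.hasSum_arrivals hT c') using 2 with n
  simp only [periodReward, c, c']
  rcases ω n with p | u
  · simp only [Sum.elim_inl]
    split_ifs <;> simp
  · simp

lemma ae_law_regular (h : m.LinearIntensities) (α : Policy K M) (t : ℝ) (z : State K M) :
    ∀ᵐ ω ∂(m.law α t z), Regular ω t m.T := by
  filter_upwards [m.ae_law_follows α t z, m.ae_law_finite_alive h α t z] with ω h1 h2
  refine ⟨⟨z, h1.1⟩, fun n q hq => ?_, h2⟩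
  have := h1.2 n
  rw [hq] at this
  obtain ⟨p, hp, hpq, -⟩ := m.mem_follows_inl this
  exact ⟨p, hp, hpq⟩

/-- The mean of the positive parts of the rewards is finite. -/
lemma tsum_lintegral_positivePart_ne_top (h : m.LinearIntensities) (hf : ∀ a, Measurable (m.f a))
    (hg : Measurable m.g) {t : ℝ} (hT : t ≤ m.T) {z : State K M} (hb : m.RewardBounds t z)
    (α : Policy K M) :
    ∑' n, ∫⁻ ω, ENNReal.ofReal (m.positivePart.periodReward α n (ω n) (ω (n + 1)))
      ∂(m.law α t z) ≠ ∞ := by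
  have hf0 : ∀ a z, 0 ≤ m.positivePart.f a z := fun a z => le_max_right _ _
  have hg0 : ∀ z, 0 ≤ m.positivePart.g z := fun z => le_max_right _ _
  have hfm : ∀ a, Measurable (m.positivePart.f a) := fun a => (hf a).max measurable_const
  have hgm : Measurable m.positivePart.g := hg.max measurable_const
  obtain ⟨hb1, c, d, hb2⟩ := hb
  have hb1 := ((le_iSup _ α).trans_lt hb1).ne
  have hpm : ∀ n, Measurable fun ω : ℕ → Node K M =>
      ENNReal.ofReal (m.positivePart.periodReward α n (ω n) (ω (n + 1))) := fun n =>
    ((m.positivePart.measurable_periodReward hfm hgm α n).comp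
      (f := fun ω : ℕ → Node K M => (ω n, ω (n + 1))) (by fun_prop)).ennreal_ofReal
  rw [← lintegral_tsum fun n => (hpm n).aemeasurable]
  have hle : ∀ᵐ ω ∂(m.law α t z),
      ∑' n, ENNReal.ofReal (m.positivePart.periodReward α n (ω n) (ω (n + 1)))
        ≤ (∫⁻ s in Icc t m.T, ENNReal.ofReal (m.f (current α ω s).1 (current α ω s).2))
          + ∑' n : ℕ, ENNReal.ofReal (c * (1 + n : ℝ) ^ d)
            * {ω : ℕ → Node K M | ω n ∈ alive m.T}.indicator 1 ω := by
    filter_upwards [m.ae_law_regular h α t z, hb2 α] with ω hω hgω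
    obtain ⟨h1, h2⟩ := m.positivePart.hasSum_periodReward (α := α) hω hT
    rw [← ENNReal.ofReal_tsum_of_nonneg
      (fun n => m.positivePart.periodReward_nonneg hf0 hg0 α n _ _) h2.summable, h2.tsum_eq,
      ENNReal.ofReal_add (intervalIntegral.integral_nonneg
        (show t ≤ m.positivePart.T from hT) fun s _ => hf0 _ _) (hg0 _)]
    refine add_le_add (le_of_eq ?_) ?_
    · change IntegrableOn _ (Icc t m.T) at h1
      change ENNReal.ofReal (∫ s in t..m.T, _) = _
      rw [intervalIntegral.integral_of_le hT, ← integral_Icc_eq_integral_Ioc,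
        ofReal_integral_eq_lintegral_ofReal h1 (Filter.Eventually.of_forall fun s => hf0 _ _)]
      refine lintegral_congr fun s => ?_
      exact ofReal_max_zero _
    · have hmem := ((hω.arrivals_eq_iff hT le_rfl (arrivals ω m.T)).1 rfl).1
      -- The polynomial bound at `N_T` is one term of the series over alive nodes, whose mean is a
      -- finite moment series.
      refine le_trans ?_ (ENNReal.le_tsum (arrivals ω m.T))
      rw [indicator_of_mem (by exact hmem), Pi.one_apply, mul_one]
      refine (ofReal_max_zero _).trans_le (ENNReal.ofReal_le_ofReal hgω)
  have hmeas : ∀ n, MeasurableSet {ω : ℕ → Node K M | ω n ∈ alive m.T} := fun n =>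
    measurable_pi_apply n (measurableSet_alive m.T)
  have hmi : ∀ n : ℕ, Measurable fun ω : ℕ → Node K M => ENNReal.ofReal (c * (1 + n : ℝ) ^ d)
      * {ω : ℕ → Node K M | ω n ∈ alive m.T}.indicator (1 : (ℕ → Node K M) → ℝ≥0∞) ω := fun n =>
    (measurable_one.indicator (hmeas n)).const_mul _
  refine ne_top_of_le_ne_top ?_ (lintegral_mono_ae hle)
  -- Additivity needs the measurability of one summand only, so that of the running reward along
  -- trajectories is never required.
  rw [lintegral_add_right _ (Measurable.tsum hmi), lintegral_tsum fun n =>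
    (hmi n).aemeasurable]
  refine ENNReal.add_ne_top.2 ⟨hb1, ?_⟩
  refine ne_of_eq_of_ne (tsum_congr fun n => ?_) (m.tsum_pow_mul_law_alive_ne_top h α t z c d)
  rw [lintegral_const_mul _ (measurable_one.indicator (hmeas n)),
    lintegral_indicator_one (hmeas n)]

/-- Every policy has the same performance in the two problems. -/
lemma expectation_mdpChain_eq_law (h : m.LinearIntensities) (hf : ∀ a, Measurable (m.f a))
    (hg : Measurable m.g) {t : ℝ} (hT : t ≤ m.T) {z : State K M} (hb : m.RewardBounds t z)
    (α : Policy K M) :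
    (expectation (m.mdpChain α t z) fun ω => ∑' n, m.stepReward α ω n)
      = expectation (m.law α t z) fun ω =>
        (∫ s in t..m.T, m.f (current α ω s).1 (current α ω s).2) + m.g (current α ω m.T).2 := by
  have hfp0 : ∀ a z, 0 ≤ m.positivePart.f a z := fun a z => le_max_right _ _
  have hgp0 : ∀ z, 0 ≤ m.positivePart.g z := fun z => le_max_right _ _
  have hfp : ∀ a, Measurable (m.positivePart.f a) := fun a => (hf a).max measurable_const
  have hgp : Measurable m.positivePart.g := hg.max measurable_const
  have hfn0 : ∀ a z, 0 ≤ m.negativePart.f a z := fun a z => le_max_right _ _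
  have hgn0 : ∀ z, 0 ≤ m.negativePart.g z := fun z => le_max_right _ _
  have hfn : ∀ a, Measurable (m.negativePart.f a) := fun a => (hf a).neg.max measurable_const
  have hgn : Measurable m.negativePart.g := hg.neg.max measurable_const
  -- The laws of the chains do not involve the rewards, so those of `m.positivePart` and
  -- `m.negativePart` are by definition those of `m`.
  have hp : ∀ n, ∫⁻ ω, ENNReal.ofReal (m.positivePart.periodReward α n (ω n) (ω (n + 1)))
      ∂(m.law α t z) = ∫⁻ ω, ENNReal.ofReal (m.positivePart.stepReward α ω n)
      ∂(m.mdpChain α t z) :=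
    m.positivePart.lintegral_periodReward_law hfp hgp hfp0 hgp0 α t z
  have hn : ∀ n, ∫⁻ ω, ENNReal.ofReal (m.negativePart.periodReward α n (ω n) (ω (n + 1)))
      ∂(m.law α t z) = ∫⁻ ω, ENNReal.ofReal (m.negativePart.stepReward α ω n)
      ∂(m.mdpChain α t z) :=
    m.negativePart.lintegral_periodReward_law hfn hgn hfn0 hgn0 α t z
  have hfin := m.tsum_lintegral_positivePart_ne_top h hf hg hT hb α
  have e1 := expectation_tsum_sub (P := m.law α t z)
    (X := fun ω => (∫ s in t..m.T, m.f (current α ω s).1 (current α ω s).2)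
      + m.g (current α ω m.T).2)
    (a := fun n ω => m.positivePart.periodReward α n (ω n) (ω (n + 1)))
    (b := fun n ω => m.negativePart.periodReward α n (ω n) (ω (n + 1)))
    (fun n => (m.positivePart.measurable_periodReward hfp hgp α n).comp
      (g := fun q : Node K M × Node K M => m.positivePart.periodReward α n q.1 q.2)
      (f := fun ω : ℕ → Node K M => (ω n, ω (n + 1))) (by fun_prop))
    (fun n => (m.negativePart.measurable_periodReward hfn hgn α n).comp
      (g := fun q : Node K M × Node K M => m.negativePart.periodReward α n q.1 q.2)
      (f := fun ω : ℕ → Node K M => (ω n, ω (n + 1))) (by fun_prop))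
    (fun n ω => m.positivePart.periodReward_nonneg hfp0 hgp0 α n _ _)
    (fun n ω => m.negativePart.periodReward_nonneg hfn0 hgn0 α n _ _)
    ((m.ae_law_finite_alive h α t z).mono fun ω hω => hω.subset fun n hn => by
      by_contra hx
      exact hn.elim (fun h' => h' (m.positivePart.periodReward_of_notMem α n hx _))
        fun h' => h' (m.negativePart.periodReward_of_notMem α n hx _))
    ((m.ae_law_regular h α t z).mono fun ω hω => by
      rw [← (m.hasSum_periodReward hω hT).2.tsum_eq]
      exact tsum_congr fun n => m.periodReward_eq_sub α n _ _)
    hfin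
  -- The finite mean of the positive parts passes term by term to the decision process, where
  -- nothing is assumed about rewards.
  simp_rw [hp] at hfin
  have e2 := expectation_tsum_sub (P := m.mdpChain α t z) (X := fun ω => ∑' n, m.stepReward α ω n)
    (a := fun n ω => m.positivePart.stepReward α ω n)
    (b := fun n ω => m.negativePart.stepReward α ω n)
    (m.positivePart.measurable_stepReward hfp hgp α)
    (m.negativePart.measurable_stepReward hfn hgn α)
    (fun n ω => m.positivePart.stepReward_nonneg hfp0 hgp0 α ω n)
    (fun n ω => m.negativePart.stepReward_nonneg hfn0 hgn0 α ω n)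
    ((m.ae_mdpChain_finite_alive h α t z).mono fun ω hω => hω.subset fun n hn => by
      by_contra hx
      exact hn.elim (fun h' => h' (m.positivePart.stepReward_of_notMem α hx))
        fun h' => h' (m.negativePart.stepReward_of_notMem α hx))
    (Filter.Eventually.of_forall fun ω => tsum_congr fun n => m.stepReward_eq_sub α ω n)
    hfin
  rw [e1, e2]
  simp_rw [hp, hn]

end Model

end MarketMaking

end

theorem proposition3p1 {K M : ℕ} (m : MarketMaking.Model K M)
    (hintensity : m.LinearIntensities)
    (hf : ∀ a, Measurable (m.f a)) (hg : Measurable m.g)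
    (hrewards : ∀ t ∈ Set.Icc 0 m.T, ∀ z, m.RewardBounds t z) :
    ∀ t ∈ Set.Icc 0 m.T, ∀ z : MarketMaking.State K M, m.mdpValue t z = m.value t z := by
  intro t ht z
  exact iSup_congr fun α =>
    m.expectation_mdpChain_eq_law hintensity hf hg ht.2 (hrewards t ht z) α
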